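/- Let $1\le q<\infty$, $1\le r\le\infty$, $\varrho\ge 0$, $\sigma>0$, $C>0$ and put $\gamma=\frac{q+\varrho}{\sigma}$. Let $(\Sigma,\mu)$ be a $\sigma$-finite measure space, $\omega\ge 0$, and let $A\subseteq L^q(\Sigma,\mu)\times L^q(\Sigma,\mu)$ be a (possibly multi-valued) operator with dense domain such that $A+\omega I$ is $m$-completely accretive in $L^q(\Sigma,\mu)$, i.e. for every $\lambda>0$ the resolvent $J_\lambda=(I+\lambda(A+\omega I))^{-1}$ satisfies $\int_\Sigma j(J_\lambda f-J_\lambda g)\,d\mu\le\int_\Sigma j(f-g)\,d\mu$ for all $f,g\in Rg(I+\lambda(A+\omega I))$ and all convex, lower semicontinuous $j:\mathbb R\to[0,\infty]$ with $j(0)=0$, and $Rg(I+\lambda(A+\omega I))=L^q(\Sigma,\mu)$ for some $\lambda>0$. Let $(u_0,0)\in A$ with $u_0\in L^1\cap L^\infty(\Sigma,\mu)$, and suppose that $A$ satisfies the Gagliardo–Nirenberg type inequality $$\|u-u_0\|_r^{\sigma}\le C\,\Big([u-u_0,v]_q+\omega\|u-u_0\|_q^q\Big)\,\|u-u_0\|_q^{\varrho}\qquad\text{for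 all }(u,v)\in A,$$ where $[u,v]_q=\lim_{\lambda\to0+}\frac{\frac1q\|u+\lambda v\|_q^q-\frac1q\|u\|_q^q}{\lambda}$. Let $\{T_t\}_{t\ge0}$ be the semigroup generated by $-A$ on $L^q(\Sigma,\mu)$, $T_tu=\lim_{n\to\infty}(I+\frac tnA)^{-n}u$ (the limit exists in $L^q$). Then: (1) For every $t>0$ and $u\in L^q(\Sigma,\mu)$, $$\|T_tu-u_0\|_r\le\Big(\frac Cq\Big)^{1/\sigma}t^{-\alpha}e^{\omega\beta t}\|u-u_0\|_q^{\gamma},\qquad \alpha=\tfrac1\sigma,\quad \beta=\gamma+1 .$$ (2) Suppose moreover that $r<\infty$ and $\gamma r>q$. Let $m_0\ge q\gamma^{-1}$ satisfy $d:=\big(\frac{\gamma r}{q}-1\big)m_0+q\big(\frac1\gamma-1\big)>0$, and set $$\alpha^*=\frac{\sigma^{-1}q\gamma^{-1}}{d},\qquad \beta^*=\frac{\gamma^2rq^{-1}-1}{d}+1,\qquad \gamma^*=\frac{(\gamma rq^{-1}-1)m_0}{d}.$$ Let $1\le s\le\gamma rq^{-1}m_0$, put $\theta=\frac{sq}{\gamma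 rm_0}$, suppose that $\gamma^*(1-\theta)<1$, and set $$\alpha_s=\frac{\alpha^*}{1-\gamma^*(1-\theta)},\qquad \beta_s=\frac{\frac12\beta^*+\gamma^*\theta}{1-\gamma^*(1-\theta)},\qquad \gamma_s=\frac{\gamma^*\theta}{1-\gamma^*(1-\theta)}.$$ Then for every $t>0$ the restriction of $T_t$ to $L^q\cap L^s(\Sigma,\mu)$ has a unique continuous extension to a mapping of $L^s(\Sigma,\mu)$ into itself, again denoted by $T_t$, and there is a constant $K>0$, depending only on $q,r,\varrho,\sigma,C,m_0,s$, such that $$\|T_tu-u_0\|_\infty\le K\,t^{-\alpha_s}\,e^{\omega\beta_st}\,\|u-u_0\|_s^{\gamma_s}\qquad\text{for every }t>0,\ u\in L^s(\Sigma,\mu).$$ -/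

import Mathlib

open MeasureTheory Filter Topology
open scoped ENNReal NNReal

noncomputable section

namespace NonlinearSemigroup

section Operators

variable {Ω : Type*} [MeasurableSpace Ω] {μ : Measure Ω} {q : ℝ≥0} [Fact (1 ≤ (q : ℝ≥0∞))]

/-- A (possibly multi-valued) operator on `L^q(Ω, μ)`, identified with its graph. -/
abbrev Operator (q : ℝ≥0) (μ : Measure Ω) : Type _ :=
  Set (Lp ℝ (q : ℝ≥0∞) μ × Lp ℝ (q : ℝ≥0∞) μ)

/-- The effective domain `D(A)`. -/
def Operator.domain (A : Operator q μ) : Set (Lp ℝ (q : ℝ≥0∞) μ) :=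
  {u | ∃ v, (u, v) ∈ A}

/-- The operator `A + ω I`. -/
def Operator.addScalar (A : Operator q μ) (ω : ℝ) : Operator q μ :=
  {p | ∃ v, (p.1, v) ∈ A ∧ p.2 = v + ω • p.1}

/-- The graph of the resolvent `J_l = (I + l A)⁻¹`: the relation `u ∈ J_l f`,
i.e. `f ∈ u + l A u`. -/
def Operator.ResolventRel (A : Operator q μ) (l : ℝ) (f u : Lp ℝ (q : ℝ≥0∞) μ) : Prop :=
  ∃ v, (u, v) ∈ A ∧ u + l • v = f

/-- The set of all convex, lower semicontinuous `j : ℝ → [0, ∞]` with `j 0 = 0`. -/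
def J₀ : Set (ℝ → ℝ≥0∞) :=
  {j | ConvexOn ℝ≥0 Set.univ j ∧ LowerSemicontinuous j ∧ j 0 = 0}

/-- `A` is completely accretive: for every `l > 0` the resolvent `J_l` is a complete contraction,
`∫ j(J_l f - J_l g) ≤ ∫ j(f - g)` for all `j ∈ J₀` and all `f, g` in the range of `I + l A`.
(With `j = |·|` this contains that `J_l` is single-valued.) -/
def Operator.CompletelyAccretive (A : Operator q μ) : Prop :=
  ∀ l : ℝ, 0 < l → ∀ f g u w : Lp ℝ (q : ℝ≥0∞) μ,
    A.ResolventRel l f u → A.ResolventRel l g w → ∀ j ∈ J₀,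
      ∫⁻ x, j (u x - w x) ∂μ ≤ ∫⁻ x, j (f x - g x) ∂μ

/-- `A` is `m`-completely accretive: completely accretive, and `Rg(I + l A) = L^q` for some
`l > 0`. -/
def Operator.MCompletelyAccretive (A : Operator q μ) : Prop :=
  A.CompletelyAccretive ∧
    ∃ l : ℝ, 0 < l ∧ ∀ f : Lp ℝ (q : ℝ≥0∞) μ, ∃ u, A.ResolventRel l f u

/-- The `q`-bracket `[u, v]_q`: the right-hand derivative at `0` of
`l ↦ (1/q) ‖u + l v‖_q ^ q`. -/
def qBracket (u v : Lp ℝ (q : ℝ≥0∞) μ) : ℝ :=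
  derivWithin (fun l : ℝ => (1 / (q : ℝ)) * ‖u + l • v‖ ^ (q : ℝ)) (Set.Ioi 0) 0

/-- The limit that defines the `q`-bracket always exists. -/
theorem tendsto_qBracket (u v : Lp ℝ (q : ℝ≥0∞) μ) :
    Tendsto (fun l : ℝ => ((1 / (q : ℝ)) * ‖u + l • v‖ ^ (q : ℝ) -
      (1 / (q : ℝ)) * ‖u‖ ^ (q : ℝ)) / l) (𝓝[>] 0) (𝓝 (qBracket u v)) := by
  have hq : (1 : ℝ) ≤ q := by
    have h : (1 : ℝ≥0∞) ≤ q := Fact.out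
    exact_mod_cast h
  have hconv : ConvexOn ℝ Set.univ
      (fun l : ℝ => (1 / (q : ℝ)) * ‖u + l • v‖ ^ (q : ℝ)) := by
    refine ⟨convex_univ, fun x _ y _ a b ha hb hab => ?_⟩
    have h1 : ‖u + (a • x + b • y) • v‖ ≤ a * ‖u + x • v‖ + b * ‖u + y • v‖ := by
      have : u + (a • x + b • y) • v = a • (u + x • v) + b • (u + y • v) := by
        have hu : u = (a + b) • u := by rw [hab, one_smul]
        nth_rewrite 1 [hu]
        simp only [smul_add, add_smul, smul_smul, smul_eq_mul]
        abel
      rw [this]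
      refine (norm_add_le _ _).trans ?_
      rw [norm_smul, norm_smul, Real.norm_of_nonneg ha, Real.norm_of_nonneg hb]
    have h2 := (convexOn_rpow hq).2 (Set.mem_Ici.2 (norm_nonneg (u + x • v)))
      (Set.mem_Ici.2 (norm_nonneg (u + y • v))) ha hb hab
    have h3 := Real.rpow_le_rpow (norm_nonneg _) h1 (zero_le_one.trans hq)
    simp only [smul_eq_mul] at h2 h3 ⊢
    have h4 := mul_le_mul_of_nonneg_left (h3.trans h2) (show (0 : ℝ) ≤ 1 / q by positivity)
    linarith
  have hd := (hconv.differentiableWithinAt_Ioi_of_mem_interior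
    (x := 0) (by simp)).hasDerivWithinAt
  rw [hasDerivWithinAt_iff_tendsto_slope' (by simp)] at hd
  refine hd.congr fun l => ?_
  simp [slope_def_field]

/-- `A` satisfies, for the element `u₀`, the `L^q`-`L^r` Gagliardo-Nirenberg type inequality
(without differences) `‖u - u₀‖_r ^ σ ≤ C ([u - u₀, v]_q + ω ‖u - u₀‖_q ^ q) ‖u - u₀‖_q ^ ρ`
for all `(u, v) ∈ A`; in particular the left-hand side is finite. -/
def Operator.GagliardoNirenberg (A : Operator q μ) (r : ℝ≥0∞) (ρ σ ω C : ℝ)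
    (u₀ : Lp ℝ (q : ℝ≥0∞) μ) : Prop :=
  ∀ u v : Lp ℝ (q : ℝ≥0∞) μ, (u, v) ∈ A →
    MemLp (u - u₀ : Lp ℝ (q : ℝ≥0∞) μ) r μ ∧
    (eLpNorm (u - u₀ : Lp ℝ (q : ℝ≥0∞) μ) r μ).toReal ^ σ ≤
      C * (qBracket (u - u₀) v + ω * ‖u - u₀‖ ^ (q : ℝ)) * ‖u - u₀‖ ^ ρ

open Classical in
/-- The resolvent `J_l = (I + l A)⁻¹` as a function (with value `0` off `Rg(I + l A)`). -/
def Operator.resolvent (A : Operator q μ) (l : ℝ) (f : Lp ℝ (q : ℝ≥0∞) μ) :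
    Lp ℝ (q : ℝ≥0∞) μ :=
  if h : ∃ u, A.ResolventRel l f u then h.choose else 0

/-- The approximants `(I + (t/n) A)⁻ⁿ u` of the exponential formula. -/
def Operator.expApprox (A : Operator q μ) (t : ℝ) (u : Lp ℝ (q : ℝ≥0∞) μ) (n : ℕ) :
    Lp ℝ (q : ℝ≥0∞) μ :=
  (A.resolvent (t / n))^[n] u

open Classical in
/-- The semigroup `T_t` generated by `-A`, through the exponential formula
`T_t u = lim_{n → ∞} (I + (t/n) A)⁻ⁿ u` for `t > 0`, and `T_0 u = u`. -/
def Operator.semigroup (A : Operator q μ) (t : ℝ) (u : Lp ℝ (q : ℝ≥0∞) μ) :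
    Lp ℝ (q : ℝ≥0∞) μ :=
  haveI : Nonempty (Lp ℝ (q : ℝ≥0∞) μ) := ⟨0⟩
  if t = 0 then u else limUnder atTop (A.expApprox t u)

/-- `S : L^s → L^s` is a continuous extension to `L^s` of (the restriction to `L^q ∩ L^s` of)
the mapping `T : L^q → L^q`. -/
def IsContinuousExtension {s : ℝ≥0} [Fact (1 ≤ (s : ℝ≥0∞))]
    (T : Lp ℝ (q : ℝ≥0∞) μ → Lp ℝ (q : ℝ≥0∞) μ)
    (S : Lp ℝ (s : ℝ≥0∞) μ → Lp ℝ (s : ℝ≥0∞) μ) : Prop :=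
  Continuous S ∧
    ∀ (u : Lp ℝ (q : ℝ≥0∞) μ) (w : Lp ℝ (s : ℝ≥0∞) μ), u =ᵐ[μ] w → T u =ᵐ[μ] S w

/-- The standing hypotheses on `A`, `ω` and the equilibrium `u₀`. -/
structure Operator.Setting (A : Operator q μ) (r : ℝ≥0∞) (ρ σ ω C : ℝ)
    (u₀ : Lp ℝ (q : ℝ≥0∞) μ) : Prop where
  omega_nonneg : 0 ≤ ω
  mCompletelyAccretive : (A.addScalar ω).MCompletelyAccretive
  dense_domain : Dense A.domain
  equilibrium : (u₀, 0) ∈ A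
  memLp_one : MemLp u₀ 1 μ
  memLp_top : MemLp u₀ ∞ μ
  gagliardoNirenberg : A.GagliardoNirenberg r ρ σ ω C u₀

end Operators

section Exponents

/-- The number `γ = (q + ρ) / σ`. -/
def gam (q ρ σ : ℝ) : ℝ := (q + ρ) / σ

/-- The common denominator `(γ r / q - 1) m₀ + q (1 / γ - 1)`. -/
def den (q r γ m₀ : ℝ) : ℝ := (γ * r / q - 1) * m₀ + q * (1 / γ - 1)

/-- The exponent `α*`. -/
def alphaStar (q r σ γ m₀ : ℝ) : ℝ := (1 / σ) * q * (1 / γ) / den q r γ m₀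

/-- The exponent `β*`. -/
def betaStar (q r γ m₀ : ℝ) : ℝ := (γ ^ 2 * r / q - 1) / den q r γ m₀ + 1

/-- The exponent `γ*`. -/
def gammaStar (q r γ m₀ : ℝ) : ℝ := (γ * r / q - 1) * m₀ / den q r γ m₀

/-- The number `s q / (γ r m₀)`. -/
def theta (q r γ m₀ s : ℝ) : ℝ := s * q / (γ * r * m₀)

/-- The exponent `α_s`. -/
def alphaS (q r σ γ m₀ s : ℝ) : ℝ :=
  alphaStar q r σ γ m₀ / (1 - gammaStar q r γ m₀ * (1 - theta q r γ m₀ s))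

/-- The exponent `β_s`. -/
def betaS (q r γ m₀ s : ℝ) : ℝ :=
  (betaStar q r γ m₀ / 2 + gammaStar q r γ m₀ * theta q r γ m₀ s) /
    (1 - gammaStar q r γ m₀ * (1 - theta q r γ m₀ s))

/-- The exponent `γ_s`. -/
def gammaS (q r γ m₀ s : ℝ) : ℝ :=
  gammaStar q r γ m₀ * theta q r γ m₀ s /
    (1 - gammaStar q r γ m₀ * (1 - theta q r γ m₀ s))

end Exponents

end NonlinearSemigroup

end

/-! Complete accretivity of `A + ω I` makes the resolvents of `A`, and hence `T_t`, contract every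
level integral `∫ (|f| - k)₊ ^ p` of a difference, up to powers of `e^{ωt}`
(`levelInt_semigroup_le`). Taking `k = 0` gives all `L^p` bounds; the vanishing of the integral
gives the sup bound. That the exponential formula converges is the Crandall–Liggett theorem, proved
through Kobayashi's estimate.

For (1), test the Gagliardo–Nirenberg inequality along the implicit Euler scheme. By convexity the
bracket is at most a difference quotient of `‖u - u₀‖_q ^ q / q`, so summation telescopes. The
`r`-norm at the final step is controlled by that at each earlier one, and the sum bounds `t ‖T_t u -
u₀‖_r ^ σ` (`euler_estimate`).

For (2), let `f = u - u₀` and let `g` be the part of `f` beyond height `k`. The data `u` and `u₀ +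
g` differ by at most `k`, so their solutions differ by at most `e^{ωt} k`. Applying (1) to `u₀ + g`
bounds the `r`-level integral of `T_t u - u₀` above `e^{ωt} k` by the power `κ = γ r / q > 1` of the
`q`-level integral of `f` above `k`. This superlinear gain feeds a De Giorgi iteration over rising
levels and the times `t (1 - 2⁻ⁿ)` (`ae_abs_semigroup_sub_le_of_level`). For bounded data it gives a
sup bound containing a power `η < 1` of the initial supremum, which is absorbed by repeated halving
of time (`absorb`).

The resulting exponents are `(r/σ)/D` and `s (κ - 1)/D` with `D = (s - q)(κ - 1) + (r - q)`. They
coincide with `α_s` and `γ_s`: the parameter `m₀` cancels. The exponential rate can be lowered to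
anything above `γ_s` (`improve_exponential`), and `β_s > γ_s` because `β* > 0`. Density of bounded
data in `L^s` and Fatou's lemma give all of `L^s`. -/

namespace NonlinearSemigroup

/-! ### Kobayashi's estimate for resolvents of quasi-accretive operators. -/

section CrandallLiggett

variable {X : Type*} [NormedAddCommGroup X] [NormedSpace ℝ X]

/-- `A + ω I` is accretive in the normed space `X`, and `J l` is the resolvent `(I + l A)⁻¹` for
all `l > 0` with `ω l < 1`. -/
structure IsResolventFamily (A : Set (X × X)) (ω : ℝ) (J : ℝ → X → X) : Prop where
  omega_nonneg : 0 ≤ ω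
  accretive : ∀ ⦃u v u' v' : X⦄, (u, v) ∈ A → (u', v') ∈ A → ∀ δ : ℝ, 0 < δ → ω * δ < 1 →
    (1 - ω * δ) * ‖u - u'‖ ≤ ‖u - u' + δ • (v - v')‖
  resolvent : ∀ l : ℝ, 0 < l → ω * l < 1 → ∀ f : X, ∃ v, (J l f, v) ∈ A ∧ J l f + l • v = f

namespace IsResolventFamily

variable {A : Set (X × X)} {ω : ℝ} {J : ℝ → X → X}

theorem norm_sub_le (h : IsResolventFamily A ω J) {l : ℝ} (hl : 0 < l) (hωl : ω * l < 1)
    (f g : X) : ‖J l f - J l g‖ ≤ (1 - ω * l)⁻¹ * ‖f - g‖ := by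
  obtain ⟨v, hv, hf⟩ := h.resolvent l hl hωl f
  obtain ⟨w, hw, hg⟩ := h.resolvent l hl hωl g
  have h1 := h.accretive hv hw l hl hωl
  have h2 : J l f - J l g + l • (v - w) = f - g := by
    calc _ = (J l f + l • v) - (J l g + l • w) := by rw [smul_sub]; abel
      _ = f - g := by rw [hf, hg]
  rw [h2] at h1
  rw [inv_mul_eq_div, le_div_iff₀ (by linarith)]
  linarith

theorem norm_iterate_sub_le (h : IsResolventFamily A ω J) {l : ℝ} (hl : 0 < l)
    (hωl : ω * l < 1) (f g : X) (n : ℕ) :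
    ‖(J l)^[n] f - (J l)^[n] g‖ ≤ (1 - ω * l)⁻¹ ^ n * ‖f - g‖ := by
  have h0 : 0 ≤ (1 - ω * l)⁻¹ := inv_nonneg.2 (by linarith)
  induction n with
  | zero => simp
  | succ n ih =>
    rw [Function.iterate_succ_apply', Function.iterate_succ_apply', pow_succ', mul_assoc]
    exact (h.norm_sub_le hl hωl _ _).trans (mul_le_mul_of_nonneg_left ih h0)

theorem apply_eq (h : IsResolventFamily A ω J) {l : ℝ} (hl : 0 < l) (hωl : ω * l < 1)
    {u v : X} (huv : (u, v) ∈ A) : J l (u + l • v) = u := by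
  obtain ⟨w, hw, hf⟩ := h.resolvent l hl hωl (u + l • v)
  have h1 := h.accretive hw huv l hl hωl
  have h2 : J l (u + l • v) - u + l • (w - v) = 0 := by
    rw [smul_sub]
    calc _ = (J l (u + l • v) + l • w) - (u + l • v) := by abel
      _ = 0 := by rw [hf, sub_self]
  rw [h2, norm_zero] at h1
  have h3 : ‖J l (u + l • v) - u‖ ≤ 0 := by
    by_contra! hc
    have := mul_pos (show 0 < 1 - ω * l by linarith) hc
    linarith
  exact sub_eq_zero.1 (norm_le_zero_iff.1 h3)

/-- Since `J l (u + l • v) = u`, consecutive iterates of `u` are iterates of two points at distance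
`l ‖v‖`. -/
theorem norm_iterate_sub_self_le (h : IsResolventFamily A ω J) {l : ℝ} (hl : 0 < l)
    (hωl : ω * l < 1) {u v : X} (huv : (u, v) ∈ A) (n : ℕ) :
    ‖(J l)^[n] u - u‖ ≤ (1 - ω * l)⁻¹ ^ n * (n * l * ‖v‖) := by
  have hc : 1 ≤ (1 - ω * l)⁻¹ := by
    rw [one_le_inv₀ (by linarith)]
    nlinarith [h.omega_nonneg]
  induction n with
  | zero => simp
  | succ n ih =>
    have h1 : ‖(J l)^[n + 1] u - (J l)^[n + 1] (u + l • v)‖ ≤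
        (1 - ω * l)⁻¹ ^ (n + 1) * (l * ‖v‖) := by
      refine (h.norm_iterate_sub_le hl hωl _ _ _).trans_eq ?_
      rw [sub_add_cancel_left, norm_neg, norm_smul, Real.norm_of_nonneg hl.le]
    have h2 : (J l)^[n + 1] (u + l • v) = (J l)^[n] u := by
      rw [Function.iterate_succ_apply, h.apply_eq hl hωl huv]
    rw [h2] at h1
    have h3 := norm_add_le ((J l)^[n + 1] u - (J l)^[n] u) ((J l)^[n] u - u)
    rw [sub_add_sub_cancel] at h3
    have h4 : (1 - ω * l)⁻¹ ^ n * (n * l * ‖v‖) ≤ (1 - ω * l)⁻¹ ^ (n + 1) * (n * l * ‖v‖) :=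
      mul_le_mul_of_nonneg_right (pow_le_pow_right₀ hc (Nat.le_succ n)) (by positivity)
    push_cast
    linarith

/-- With `δ = l m / (l + m)` in the accretivity inequality, the right-hand vector becomes a convex
combination of `f - J m g` and `J l f - g`. This links two different step sizes. -/
theorem norm_sub_le_of_two_steps (h : IsResolventFamily A ω J) {l m : ℝ} (hl : 0 < l)
    (hωl : ω * l < 1) (hm : 0 < m) (hωm : ω * m < 1) (f g : X) :
    (1 - ω * (l * m / (l + m))) * ‖J l f - J m g‖ ≤
      m / (l + m) * ‖f - J m g‖ + l / (l + m) * ‖J l f - g‖ := by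
  obtain ⟨v, hv, hf⟩ := h.resolvent l hl hωl f
  obtain ⟨w, hw, hg⟩ := h.resolvent m hm hωm g
  have hlm : 0 < l + m := by linarith
  have h1 := h.accretive hv hw (l * m / (l + m)) (by positivity) (by
    have : l * m / (l + m) ≤ l := by
      rw [div_le_iff₀ hlm]; nlinarith
    exact (mul_le_mul_of_nonneg_left this h.omega_nonneg).trans_lt hωl)
  refine h1.trans ?_
  have h2 : J l f - J m g + (l * m / (l + m)) • (v - w) =
      (m / (l + m)) • (f - J m g) + (l / (l + m)) • (J l f - g) := by
    have e1 : f - J m g = J l f + l • v - J m g := by rw [hf]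
    have e2 : J l f - g = J l f - (J m g + m • w) := by rw [hg]
    rw [e1, e2]
    match_scalars <;> field_simp <;> ring
  rw [h2]
  refine (norm_add_le _ _).trans_eq ?_
  rw [norm_smul, norm_smul, Real.norm_of_nonneg (by positivity),
    Real.norm_of_nonneg (by positivity)]

/-- Double induction on `(i, j)`: the two-step inequality bounds each entry by a weighted mean of
its two predecessors, and the square root is a supersolution of that recursion. -/
theorem kobayashi_estimate (h : IsResolventFamily A ω J) {l m : ℝ} (hl : 0 < l)
    (hωl : ω * l < 1) (hm : 0 < m) (hωm : ω * m < 1) {u v : X} (huv : (u, v) ∈ A) (i j : ℕ) :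
    ‖(J l)^[i] u - (J m)^[j] u‖ ≤ (1 - ω * l)⁻¹ ^ i * (1 - ω * m)⁻¹ ^ j *
      (‖v‖ * √((i * l - j * m) ^ 2 + i * l ^ 2 + j * m ^ 2)) := by
  have hbase : ∀ {l : ℝ}, 0 < l → ∀ n : ℕ, (n : ℝ) * l * ‖v‖ ≤
      ‖v‖ * √((n * l) ^ 2 + n * l ^ 2) := fun {l} hl n => by
    rw [mul_comm]
    refine mul_le_mul_of_nonneg_left (Real.le_sqrt_of_sq_le ?_) (norm_nonneg _)
    have : 0 ≤ (n : ℝ) * l ^ 2 := by positivity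
    linarith
  have h1l : 0 < 1 - ω * l := by linarith
  have h1m : 0 < 1 - ω * m := by linarith
  induction i generalizing j with
  | zero =>
    rw [norm_sub_rev]
    refine (h.norm_iterate_sub_self_le hm hωm huv j).trans ?_
    simpa using mul_le_mul_of_nonneg_left (hbase hm j)
      (show 0 ≤ (1 - ω * m)⁻¹ ^ j by positivity)
  | succ i ihi =>
    induction j with
    | zero =>
      refine (h.norm_iterate_sub_self_le hl hωl huv (i + 1)).trans ?_
      simpa using mul_le_mul_of_nonneg_left (hbase hl (i + 1))
        (show 0 ≤ (1 - ω * l)⁻¹ ^ (i + 1) by positivity)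
    | succ j ihj =>
      have h1 := ihi (j + 1)
      have hlm : 0 < l + m := by linarith
      set a := (1 - ω * l)⁻¹ with ha
      set b := (1 - ω * m)⁻¹ with hb
      set p := m / (l + m) with hp
      set p' := l / (l + m) with hp'
      have hpp : p + p' = 1 := by rw [hp, hp']; field_simp; ring
      set d := 1 - ω * (l * m / (l + m)) with hd
      have hp0 : 0 ≤ p := by positivity
      have hp0' : 0 ≤ p' := by positivity
      have hdl : 1 - ω * l ≤ d := by
        have : l * m / (l + m) ≤ l := by rw [div_le_iff₀ hlm]; nlinarith
        have := mul_le_mul_of_nonneg_left this h.omega_nonneg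
        linarith
      have hdm : 1 - ω * m ≤ d := by
        have : l * m / (l + m) ≤ m := by rw [div_le_iff₀ hlm]; nlinarith
        have := mul_le_mul_of_nonneg_left this h.omega_nonneg
        linarith
      have h3 := h.norm_sub_le_of_two_steps hl hωl hm hωm ((J l)^[i] u) ((J m)^[j] u)
      simp only [← Function.iterate_succ_apply'] at h3
      set X1 := (((i : ℕ) : ℝ) * l - ((j + 1 : ℕ) : ℝ) * m) ^ 2 + i * l ^ 2 +
        ((j + 1 : ℕ) : ℝ) * m ^ 2 with hX1
      set X2 := (((i + 1 : ℕ) : ℝ) * l - (j : ℝ) * m) ^ 2 + ((i + 1 : ℕ) : ℝ) * l ^ 2 +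
        (j : ℝ) * m ^ 2 with hX2
      have h0X1 : 0 ≤ X1 := by positivity
      have h0X2 : 0 ≤ X2 := by positivity
      -- The radicand at `(i + 1, j + 1)` equals `p * X1 + p' * X2` exactly, so concavity of the
      -- square root suffices.
      have hconc : p * √X1 + p' * √X2 ≤ √((((i + 1 : ℕ) : ℝ) * l - ((j + 1 : ℕ) : ℝ) * m) ^ 2 +
          ((i + 1 : ℕ) : ℝ) * l ^ 2 + ((j + 1 : ℕ) : ℝ) * m ^ 2) := by
        have := Real.strictConcaveOn_sqrt.concaveOn.2 (Set.mem_Ici.2 h0X1) (Set.mem_Ici.2 h0X2)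
          hp0 hp0' hpp
        simp only [smul_eq_mul] at this
        refine this.trans_eq ?_
        congr 1
        rw [hX1, hX2, hp, hp']
        push_cast
        field_simp
        ring
      have hd0 : 0 < d := h1l.trans_le hdl
      have hea : a ^ i * (d⁻¹) ≤ a ^ (i + 1) := by
        rw [pow_succ]
        exact mul_le_mul_of_nonneg_left (inv_anti₀ h1l hdl) (by positivity)
      have heb : b ^ j * (d⁻¹) ≤ b ^ (j + 1) := by
        rw [pow_succ]
        exact mul_le_mul_of_nonneg_left (inv_anti₀ h1m hdm) (by positivity)
      have h4 : ‖(J l)^[i + 1] u - (J m)^[j + 1] u‖ ≤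
          d⁻¹ * (p * ‖(J l)^[i] u - (J m)^[j + 1] u‖ + p' * ‖(J l)^[i + 1] u - (J m)^[j] u‖) := by
        rw [inv_mul_eq_div, le_div_iff₀ hd0]
        linarith
      refine h4.trans ?_
      have ha0 : 0 ≤ a := by positivity
      have hb0 : 0 ≤ b := by positivity
      calc d⁻¹ * (p * ‖(J l)^[i] u - (J m)^[j + 1] u‖ + p' * ‖(J l)^[i + 1] u - (J m)^[j] u‖)
          ≤ d⁻¹ * (p * (a ^ i * b ^ (j + 1) * (‖v‖ * √X1)) +
            p' * (a ^ (i + 1) * b ^ j * (‖v‖ * √X2))) := by gcongr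
        _ = (a ^ i * d⁻¹) * (b ^ (j + 1) * (‖v‖ * (p * √X1))) +
            (b ^ j * d⁻¹) * (a ^ (i + 1) * (‖v‖ * (p' * √X2))) := by ring
        _ ≤ a ^ (i + 1) * (b ^ (j + 1) * (‖v‖ * (p * √X1))) +
            b ^ (j + 1) * (a ^ (i + 1) * (‖v‖ * (p' * √X2))) := by gcongr
        _ = a ^ (i + 1) * b ^ (j + 1) * (‖v‖ * (p * √X1 + p' * √X2)) := by ring
        _ ≤ _ := by gcongr

end IsResolventFamily

end CrandallLiggett

/-! ### Convergence of the exponential formula. -/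

theorem tendsto_inv_one_sub_pow (x : ℝ) :
    Tendsto (fun n : ℕ => (1 - x / n)⁻¹ ^ n) atTop (𝓝 (Real.exp x)) := by
  have := (Real.tendsto_one_add_div_pow_exp (-x)).inv₀ (Real.exp_ne_zero _)
  rw [← Real.exp_neg, neg_neg] at this
  refine this.congr fun n => ?_
  rw [inv_pow, neg_div, sub_eq_add_neg]

theorem inv_one_sub_pow_le {x : ℝ} (hx : 0 ≤ x) {n : ℕ} (hn : 2 * x ≤ n) (hn0 : 0 < n) :
    (1 - x / n)⁻¹ ^ n ≤ Real.exp (2 * x) := by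
  have hn' : (0 : ℝ) < n := by exact_mod_cast hn0
  have h1 : x / n ≤ 1 / 2 := by rw [div_le_iff₀ hn']; linarith
  have h0 : 0 ≤ x / n := by positivity
  have h2 : (1 - x / n)⁻¹ ≤ Real.exp (2 * (x / n)) := by
    refine le_trans ?_ (Real.add_one_le_exp _)
    rw [inv_le_iff_one_le_mul₀ (by linarith)]
    nlinarith
  calc (1 - x / n)⁻¹ ^ n ≤ Real.exp (2 * (x / n)) ^ n :=
        pow_le_pow_left₀ (inv_nonneg.2 (by linarith)) h2 n
    _ = Real.exp (2 * x) := by rw [← Real.exp_nat_mul]; congr 1; field_simp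

section CrandallLiggett

variable {X : Type*} [NormedAddCommGroup X] [NormedSpace ℝ X]
  {A : Set (X × X)} {ω : ℝ} {J : ℝ → X → X}

theorem eventually_two_mul_le (x : ℝ) : ∀ᶠ n : ℕ in atTop, 2 * x ≤ n ∧ 0 < n :=
  (tendsto_natCast_atTop_atTop.eventually_ge_atTop (2 * x)).and (eventually_gt_atTop 0)

theorem mul_div_lt_one {ω t : ℝ} {n : ℕ} (hn : 2 * (ω * t) ≤ n) (hn0 : 0 < n) :
    ω * (t / n) < 1 := by
  have hn' : (0 : ℝ) < n := by exact_mod_cast hn0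
  rw [← mul_div_assoc, div_lt_one hn']
  linarith

namespace IsResolventFamily

theorem norm_expApprox_sub_le (h : IsResolventFamily A ω J) {t : ℝ} (ht : 0 < t) {n : ℕ}
    (hn : 2 * (ω * t) ≤ n) (hn0 : 0 < n) (f g : X) :
    ‖(J (t / n))^[n] f - (J (t / n))^[n] g‖ ≤ Real.exp (2 * (ω * t)) * ‖f - g‖ := by
  have hn' : (0 : ℝ) < n := by exact_mod_cast hn0
  refine (h.norm_iterate_sub_le (by positivity) (mul_div_lt_one hn hn0) f g n).trans ?_
  gcongr
  rw [← mul_div_assoc]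
  exact inv_one_sub_pow_le (mul_nonneg h.omega_nonneg ht.le) hn hn0

theorem cauchySeq_of_mem (h : IsResolventFamily A ω J) {t : ℝ} (ht : 0 < t) {u v : X}
    (huv : (u, v) ∈ A) : CauchySeq fun n : ℕ => (J (t / n))^[n] u := by
  have hωt : 0 ≤ ω * t := mul_nonneg h.omega_nonneg ht.le
  set E := Real.exp (2 * (ω * t)) with hE
  have hest : ∀ N m n : ℕ, 2 * (ω * t) ≤ N → 0 < N → N ≤ m → N ≤ n →
      ‖(J (t / m))^[m] u - (J (t / n))^[n] u‖ ≤ E * E * (‖v‖ * √(2 * t ^ 2 / N)) := by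
    intro N m n hN hN0 hm hn
    have hNr : (0 : ℝ) < N := by exact_mod_cast hN0
    have hmN : (N : ℝ) ≤ m := by exact_mod_cast hm
    have hnN : (N : ℝ) ≤ n := by exact_mod_cast hn
    have hm0 : (0 : ℝ) < m := by linarith
    have hn0 : (0 : ℝ) < n := by linarith
    refine (h.kobayashi_estimate (by positivity)
      (mul_div_lt_one (hN.trans hmN) (hN0.trans_le hm)) (by positivity)
      (mul_div_lt_one (hN.trans hnN) (hN0.trans_le hn)) huv m n).trans ?_
    -- Both schemes reach the same time `t`, so the drift term vanishes and only the `O(1/N)`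
    -- variance remains.
    have e1 : (m : ℝ) * (t / m) - n * (t / n) = 0 := by field_simp; ring
    have e2 : (m : ℝ) * (t / m) ^ 2 + n * (t / n) ^ 2 ≤ 2 * t ^ 2 / N := by
      have a1 : (m : ℝ) * (t / m) ^ 2 = t ^ 2 / m := by field_simp
      have a2 : (n : ℝ) * (t / n) ^ 2 = t ^ 2 / n := by field_simp
      have a3 : t ^ 2 / m ≤ t ^ 2 / N := by gcongr
      have a4 : t ^ 2 / n ≤ t ^ 2 / N := by gcongr
      rw [a1, a2, two_mul, add_div]
      linarith
    rw [e1, zero_pow two_ne_zero, zero_add, ← mul_div_assoc, ← mul_div_assoc]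
    have b1 := inv_one_sub_pow_le hωt (hN.trans hmN) (hN0.trans_le hm)
    have b2 := inv_one_sub_pow_le hωt (hN.trans hnN) (hN0.trans_le hn)
    have b3 : 0 ≤ (1 - ω * t / n)⁻¹ ^ n := by
      have := mul_div_lt_one (hN.trans hnN) (hN0.trans_le hn)
      rw [← mul_div_assoc] at this
      exact pow_nonneg (inv_nonneg.2 (by linarith)) _
    gcongr
  have hlim : Tendsto (fun N : ℕ => E * E * (‖v‖ * √(2 * t ^ 2 / N))) atTop (𝓝 0) := by
    have h1 := (tendsto_const_div_atTop_nhds_zero_nat (2 * t ^ 2)).sqrt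
    simpa using (h1.const_mul ‖v‖).const_mul (E * E)
  rw [Metric.cauchySeq_iff]
  intro ε hε
  obtain ⟨N, ⟨hN, hN0⟩, hNε⟩ :=
    ((eventually_two_mul_le (ω * t)).and (hlim.eventually_lt_const hε)).exists
  refine ⟨N, fun m hm n hn => ?_⟩
  rw [dist_eq_norm]
  exact (hest N m n hN hN0 hm hn).trans_lt hNε

/-- The approximants are eventually Lipschitz with the constant `exp (2 ω t)` independent of `n`, so
convergence passes from the domain to its closure. -/
theorem cauchySeq_of_mem_closure (h : IsResolventFamily A ω J) {t : ℝ} (ht : 0 < t) {u : X}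
    (hu : u ∈ closure {u | ∃ v, (u, v) ∈ A}) :
    CauchySeq fun n : ℕ => (J (t / n))^[n] u := by
  rw [Metric.cauchySeq_iff']
  intro ε hε
  set E := Real.exp (2 * (ω * t)) with hE
  obtain ⟨w, ⟨v, hw⟩, hd⟩ := Metric.mem_closure_iff.1 hu (ε / (3 * E)) (by positivity)
  obtain ⟨N1, hN1⟩ := Metric.cauchySeq_iff.1 (h.cauchySeq_of_mem ht hw) (ε / 3) (by positivity)
  obtain ⟨N2, hN2⟩ := eventually_atTop.1 (eventually_two_mul_le (ω * t))
  have hclose : ∀ n ≥ N2, dist ((J (t / n))^[n] u) ((J (t / n))^[n] w) < ε / 3 := by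
    intro n hn
    rw [dist_eq_norm]
    refine (h.norm_expApprox_sub_le ht (hN2 n hn).1 (hN2 n hn).2 u w).trans_lt ?_
    rw [← dist_eq_norm]
    calc E * dist u w < E * (ε / (3 * E)) := by gcongr
      _ = ε / 3 := by
        have : E ≠ 0 := (Real.exp_pos _).ne'
        field_simp
  refine ⟨max N1 N2, fun n hn => ?_⟩
  have h1 := hclose n (le_trans (le_max_right _ _) hn)
  have h2 := hclose (max N1 N2) (le_max_right _ _)
  have h3 := hN1 n (le_trans (le_max_left _ _) hn) (max N1 N2) (le_max_left _ _)
  have h4 := dist_triangle4 ((J (t / n))^[n] u) ((J (t / n))^[n] w)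
    ((J (t / ((max N1 N2 : ℕ) : ℝ)))^[max N1 N2] w) ((J (t / ((max N1 N2 : ℕ) : ℝ)))^[max N1 N2] u)
  rw [dist_comm ((J (t / ((max N1 N2 : ℕ) : ℝ)))^[max N1 N2] w)] at h4
  linarith

/-- The exponential formula at time `2 t` is the exponential formula at time `t`, applied twice. -/
theorem tendsto_two_mul (h : IsResolventFamily A ω J) {t : ℝ} (ht : 0 < t) {u x y : X}
    (hx : Tendsto (fun n : ℕ => (J (t / n))^[n] u) atTop (𝓝 x))
    (hy : Tendsto (fun n : ℕ => (J (t / n))^[n] x) atTop (𝓝 y)) :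
    Tendsto (fun n : ℕ => (J (2 * t / (2 * n : ℕ)))^[2 * n] u) atTop (𝓝 y) := by
  have h1 : ∀ n : ℕ, (J (2 * t / (2 * n : ℕ)))^[2 * n] u =
      (J (t / n))^[n] ((J (t / n))^[n] u) := by
    intro n
    rw [← Function.iterate_add_apply, ← two_mul]
    congr 2
    push_cast
    rw [mul_div_mul_left _ _ two_ne_zero]
  simp_rw [h1]
  have h2 : Tendsto (fun n : ℕ => (J (t / n))^[n] ((J (t / n))^[n] u) - (J (t / n))^[n] x)
      atTop (𝓝 0) := by
    have h3 : Tendsto (fun n : ℕ => Real.exp (2 * (ω * t)) * ‖(J (t / n))^[n] u - x‖) atTop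
        (𝓝 0) := by
      have := (tendsto_iff_norm_sub_tendsto_zero.1 hx).const_mul (Real.exp (2 * (ω * t)))
      rwa [mul_zero] at this
    refine squeeze_zero_norm' ?_ h3
    filter_upwards [eventually_two_mul_le (ω * t)] with n hn
    exact h.norm_expApprox_sub_le ht hn.1 hn.2 _ _
  simpa using h2.add hy

end IsResolventFamily

end CrandallLiggett

end NonlinearSemigroup

namespace NonlinearSemigroup

/-! ### The range condition, from one step size to all. -/

section Range

variable {X : Type*} [NormedAddCommGroup X] [NormedSpace ℝ X] {B : Set (X × X)}

/-- The equation `u + l v = f` is equivalent to `u = J ((l₀/l) f + (1 - l₀/l) u)`, a contraction as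
soon as `|1 - l₀/l| < 1`, that is `l > l₀/2`. -/
theorem range_of_half_lt [CompleteSpace X]
    (hB : ∀ ⦃u v u' v' : X⦄, (u, v) ∈ B → (u', v') ∈ B → ∀ l : ℝ, 0 < l →
      ‖u - u'‖ ≤ ‖u - u' + l • (v - v')‖) {l₀ l : ℝ} (hl₀ : 0 < l₀) (hl : l₀ / 2 < l)
    (hr : ∀ f, ∃ u v, (u, v) ∈ B ∧ u + l₀ • v = f) (f : X) :
    ∃ u v, (u, v) ∈ B ∧ u + l • v = f := by
  choose J V hJV hJ using hr
  have hJlip : ∀ f g, ‖J f - J g‖ ≤ ‖f - g‖ := fun f g => by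
    refine (hB (hJV f) (hJV g) l₀ hl₀).trans_eq ?_
    congr 1
    calc _ = (J f + l₀ • V f) - (J g + l₀ • V g) := by rw [smul_sub]; abel
      _ = _ := by rw [hJ, hJ]
  have hl' : 0 < l := by linarith
  have hK : |1 - l₀ / l| < 1 := by
    rw [abs_lt]
    have h1 : l₀ / l < 2 := by rw [div_lt_iff₀ hl']; linarith
    have h2 : 0 < l₀ / l := by positivity
    constructor <;> linarith
  have hc : ContractingWith (Real.toNNReal |1 - l₀ / l|)
      (fun u => J ((l₀ / l) • f + (1 - l₀ / l) • u)) := by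
    refine ⟨by rwa [Real.toNNReal_lt_one], LipschitzWith.of_dist_le_mul fun u w => ?_⟩
    rw [dist_eq_norm, dist_eq_norm, Real.coe_toNNReal _ (abs_nonneg _)]
    refine (hJlip _ _).trans_eq ?_
    rw [add_sub_add_left_eq_sub, ← smul_sub, norm_smul, Real.norm_eq_abs]
  have : Nonempty X := ⟨0⟩
  set u := hc.fixedPoint with hu
  have hfix : J ((l₀ / l) • f + (1 - l₀ / l) • u) = u := hc.fixedPoint_isFixedPt
  have h1 := hJV ((l₀ / l) • f + (1 - l₀ / l) • u)
  have h2 := hJ ((l₀ / l) • f + (1 - l₀ / l) • u)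
  rw [hfix] at h1 h2
  refine ⟨u, _, h1, ?_⟩
  set w := V ((l₀ / l) • f + (1 - l₀ / l) • u)
  have h3 : l₀ • w = (l₀ / l) • f + (1 - l₀ / l) • u - u := by rw [← h2]; abel
  have h4 : l • w = (l / l₀) • (l₀ • w) := by
    rw [smul_smul]; congr 1; field_simp
  rw [h4, h3]
  match_scalars <;> field_simp
  ring

/-- Any ratio strictly between `1/2` and `1` serves to descend; `3/4` is used until half of the step
falls below `l`. -/
theorem range_of_accretive [CompleteSpace X]
    (hB : ∀ ⦃u v u' v' : X⦄, (u, v) ∈ B → (u', v') ∈ B → ∀ l : ℝ, 0 < l →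
      ‖u - u'‖ ≤ ‖u - u' + l • (v - v')‖) {l₀ l : ℝ} (hl₀ : 0 < l₀) (hl : 0 < l)
    (hr : ∀ f, ∃ u v, (u, v) ∈ B ∧ u + l₀ • v = f) (f : X) :
    ∃ u v, (u, v) ∈ B ∧ u + l • v = f := by
  have hn : ∀ n : ℕ, ∀ f, ∃ u v, (u, v) ∈ B ∧ u + ((3 / 4) ^ n * l₀) • v = f := by
    intro n
    induction n with
    | zero => simpa using hr
    | succ n ih =>
      refine range_of_half_lt hB (by positivity) ?_ ih
      rw [pow_succ]
      have : 0 < (3 / 4 : ℝ) ^ n * l₀ := by positivity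
      linarith
  obtain ⟨n, hn'⟩ := exists_pow_lt_of_lt_one (show 0 < l / l₀ by positivity)
    (show (3 / 4 : ℝ) < 1 by norm_num)
  rw [lt_div_iff₀ hl₀] at hn'
  refine range_of_half_lt hB (by positivity) ?_ (hn n) f
  have : 0 < (3 / 4 : ℝ) ^ n * l₀ := by positivity
  linarith

end Range

/-! ### Level integrals. -/

section LevelIntegral

variable {Ω : Type*} [MeasurableSpace Ω] {μ : Measure Ω}

/-- These are the only test functions `j` at which complete accretivity is used. -/
theorem ofReal_pos_part_rpow_mem_J₀ {p k : ℝ} (hp : 1 ≤ p) (hk : 0 ≤ k) :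
    (fun x : ℝ => ENNReal.ofReal (max (|x| - k) 0 ^ p)) ∈ J₀ := by
  refine ⟨⟨convex_univ, fun x _ y _ a b _ _ hab => ?_⟩, ?_, ?_⟩
  · have hab' : (a : ℝ) + b = 1 := by exact_mod_cast hab
    have h1 : max (|a • x + b • y| - k) 0 ≤
        (a : ℝ) * max (|x| - k) 0 + b * max (|y| - k) 0 := by
      refine max_le ?_ (by positivity)
      have h2 : |a • x + b • y| ≤ a * |x| + b * |y| := by
        refine (abs_add_le _ _).trans_eq ?_
        simp [NNReal.smul_def, abs_mul]
      have h3 : (a : ℝ) * (|x| - k) ≤ a * max (|x| - k) 0 :=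
        mul_le_mul_of_nonneg_left (le_max_left _ _) a.2
      have h4 : (b : ℝ) * (|y| - k) ≤ b * max (|y| - k) 0 :=
        mul_le_mul_of_nonneg_left (le_max_left _ _) b.2
      have h5 : k = a * k + b * k := by rw [← add_mul, hab', one_mul]
      linarith
    have h2 := (convexOn_rpow hp).2 (Set.mem_Ici.2 (le_max_right (|x| - k) 0))
      (Set.mem_Ici.2 (le_max_right (|y| - k) 0)) a.2 b.2 hab'
    have h3 := (Real.rpow_le_rpow (le_max_right _ _) h1 (by linarith)).trans h2
    refine (ENNReal.ofReal_le_ofReal h3).trans_eq ?_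
    simp only [smul_eq_mul, ENNReal.smul_def]
    change ENNReal.ofReal ((a : ℝ) * _ + (b : ℝ) * _) = _
    rw [ENNReal.ofReal_add (by positivity) (by positivity), ENNReal.ofReal_mul a.coe_nonneg,
      ENNReal.ofReal_mul b.coe_nonneg, ENNReal.ofReal_coe_nnreal, ENNReal.ofReal_coe_nnreal]
  · refine Continuous.lowerSemicontinuous ?_
    refine ENNReal.continuous_ofReal.comp (Continuous.rpow_const (by fun_prop) fun x => ?_)
    right; linarith
  · have : max (|(0 : ℝ)| - k) 0 = 0 := max_eq_right (by rw [abs_zero]; linarith)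
    simp only [this]
    rw [Real.zero_rpow (by linarith), ENNReal.ofReal_zero]

/-- The integral `∫ (|f| - k)₊ ^ p`. -/
noncomputable def levelInt (μ : Measure Ω) (p k : ℝ) (f : Ω → ℝ) : ℝ≥0∞ :=
  ∫⁻ x, ENNReal.ofReal (max (|f x| - k) 0 ^ p) ∂μ

theorem levelInt_congr {p k : ℝ} {f g : Ω → ℝ} (h : f =ᵐ[μ] g) :
    levelInt μ p k f = levelInt μ p k g :=
  lintegral_congr_ae (h.mono fun x hx => by simp only [hx])

theorem levelInt_const_mul {p c : ℝ} (hc : 0 ≤ c) (k : ℝ) (f : Ω → ℝ) :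
    levelInt μ p (c * k) (fun x => c * f x) = ENNReal.ofReal (c ^ p) * levelInt μ p k f := by
  rw [levelInt, levelInt, ← lintegral_const_mul' _ _ ENNReal.ofReal_ne_top]
  refine lintegral_congr fun x => ?_
  rw [← ENNReal.ofReal_mul (by positivity), ← Real.mul_rpow hc (le_max_right _ _),
    mul_max_of_nonneg _ _ hc, mul_zero, mul_sub, abs_mul, abs_of_nonneg hc]

theorem levelInt_zero_eq {p : ℝ} (hp : 1 ≤ p) (f : Ω → ℝ) :
    levelInt μ p 0 f = eLpNorm f (ENNReal.ofReal p) μ ^ p := by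
  have hp0 : 0 < p := by linarith
  rw [eLpNorm_eq_lintegral_rpow_enorm_toReal (by simpa using hp0) ENNReal.ofReal_ne_top,
    ENNReal.toReal_ofReal hp0.le, ← ENNReal.rpow_mul, one_div, inv_mul_cancel₀ hp0.ne',
    ENNReal.rpow_one]
  refine lintegral_congr fun x => ?_
  rw [sub_zero, max_eq_left (abs_nonneg _), ← ENNReal.ofReal_rpow_of_nonneg (abs_nonneg _) hp0.le,
    Real.enorm_eq_ofReal_abs]

theorem levelInt_eq_zero_iff {p k : ℝ} (hp : 0 < p) {f : Ω → ℝ}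
    (hf : AEStronglyMeasurable f μ) : levelInt μ p k f = 0 ↔ ∀ᵐ x ∂μ, |f x| ≤ k := by
  have hfm := hf.aemeasurable
  rw [levelInt, lintegral_eq_zero_iff' (by fun_prop)]
  refine eventually_congr (Eventually.of_forall fun x => ?_)
  simp only [Pi.zero_apply, ENNReal.ofReal_eq_zero]
  constructor
  · intro h
    by_contra! hc
    have h1 : 0 < max (|f x| - k) 0 := lt_max_of_lt_left (by linarith)
    exact absurd (Real.rpow_pos_of_pos h1 p) (not_lt.2 h)
  · intro h
    rw [max_eq_right (by linarith), Real.zero_rpow hp.ne']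

theorem levelInt_anti {p k k' : ℝ} (hp : 0 ≤ p) (h : k ≤ k') (f : Ω → ℝ) :
    levelInt μ p k' f ≤ levelInt μ p k f := by
  refine lintegral_mono fun x => ENNReal.ofReal_le_ofReal ?_
  exact Real.rpow_le_rpow (le_max_right _ _) (max_le_max (by linarith) le_rfl) hp

theorem ae_abs_le_of_eLpNorm_top_le {f : Ω → ℝ} {k : ℝ} (hk : 0 ≤ k)
    (h : eLpNorm f ∞ μ ≤ ENNReal.ofReal k) : ∀ᵐ x ∂μ, |f x| ≤ k := by
  rw [eLpNorm_exponent_top] at h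
  filter_upwards [ae_le_eLpNormEssSup (f := f) (μ := μ)] with x hx
  have := hx.trans h
  rwa [Real.enorm_eq_ofReal_abs, ENNReal.ofReal_le_ofReal_iff hk] at this

theorem eLpNorm_top_le_of_ae_abs_le {f : Ω → ℝ} {k : ℝ} (h : ∀ᵐ x ∂μ, |f x| ≤ k) :
    eLpNorm f ∞ μ ≤ ENNReal.ofReal k := by
  rw [eLpNorm_exponent_top]
  exact eLpNormEssSup_le_of_ae_bound h

/-- A map that contracts all the level integrals contracts all `L^p`-norms. -/
theorem eLpNorm_le_of_levelInt_le {f g : Ω → ℝ} {c : ℝ} (hc : 0 < c)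
    (hf : AEStronglyMeasurable f μ) (hg : AEStronglyMeasurable g μ)
    (h : ∀ p k : ℝ, 1 ≤ p → 0 ≤ k →
      levelInt μ p (c * k) f ≤ ENNReal.ofReal (c ^ p) * levelInt μ p k g)
    {p : ℝ≥0∞} (hp : 1 ≤ p) : eLpNorm f p μ ≤ ENNReal.ofReal c * eLpNorm g p μ := by
  by_cases htop : p = ∞
  · subst htop
    by_cases hg' : eLpNorm g ∞ μ = ∞
    · rw [hg', ENNReal.mul_top (by simpa using hc)]
      exact le_top
    -- A sup bound is the vanishing of the level integral at that height.
    have h1 : levelInt μ 1 (eLpNorm g ∞ μ).toReal g = 0 :=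
      (levelInt_eq_zero_iff one_pos hg).2 (ae_abs_le_of_eLpNorm_top_le ENNReal.toReal_nonneg
        (ENNReal.ofReal_toReal hg').ge)
    have h2 := h 1 _ le_rfl (ENNReal.toReal_nonneg (a := eLpNorm g ∞ μ))
    rw [h1, mul_zero, nonpos_iff_eq_zero, levelInt_eq_zero_iff one_pos hf] at h2
    refine (eLpNorm_top_le_of_ae_abs_le h2).trans_eq ?_
    rw [ENNReal.ofReal_mul hc.le, ENNReal.ofReal_toReal hg']
  · have hp1 : 1 ≤ p.toReal := by
      rw [← ENNReal.toReal_one]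
      exact (ENNReal.toReal_le_toReal ENNReal.one_ne_top htop).2 hp
    have h1 := h p.toReal 0 hp1 le_rfl
    rw [mul_zero, levelInt_zero_eq hp1, levelInt_zero_eq hp1, ENNReal.ofReal_toReal htop,
      ← ENNReal.ofReal_rpow_of_nonneg hc.le (by linarith),
      ← ENNReal.mul_rpow_of_nonneg _ _ (by linarith)] at h1
    exact (ENNReal.rpow_le_rpow_iff (by linarith)).1 h1

end LevelIntegral

/-! ### Contraction properties of the resolvents of `A`. -/

section Resolvent

variable {Ω : Type*} [MeasurableSpace Ω] {μ : Measure Ω} {q : ℝ≥0} [Fact (1 ≤ (q : ℝ≥0∞))]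
  {A : Operator q μ} {ω : ℝ}

-- Dividing `f = u + h v` by `1 - ω h` gives `u + (h / (1 - ω h)) (v + ω u)`. This trades a
-- resolvent of `A` for one of the accretive operator `A + ω I`, at the price of the factor `(1 - ω
-- h)⁻¹`.
set_option linter.unusedSectionVars false in
theorem Operator.addScalar_resolventRel {h : ℝ} (hh : ω * h < 1)
    {f u : Lp ℝ (q : ℝ≥0∞) μ} (hu : A.ResolventRel h f u) :
    (A.addScalar ω).ResolventRel (h / (1 - ω * h)) ((1 - ω * h)⁻¹ • f) u := by
  obtain ⟨v, hv, rfl⟩ := hu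
  refine ⟨v + ω • u, ⟨v, hv, rfl⟩, ?_⟩
  have : 1 - h * ω ≠ 0 := by linarith [mul_comm ω h]
  match_scalars <;> field_simp
  ring

/-- The resolvents of `A` contract the level integrals, up to the factor `(1 - ω h)⁻¹`. -/
theorem Operator.levelInt_resolventRel_le (hA : (A.addScalar ω).CompletelyAccretive)
    {h : ℝ} (hh : 0 < h) (hωh : ω * h < 1) {f g u w : Lp ℝ (q : ℝ≥0∞) μ}
    (hu : A.ResolventRel h f u) (hw : A.ResolventRel h g w) {p k : ℝ} (hp : 1 ≤ p) (hk : 0 ≤ k) :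
    levelInt μ p ((1 - ω * h)⁻¹ * k) (u - w : Lp ℝ (q : ℝ≥0∞) μ) ≤
      ENNReal.ofReal ((1 - ω * h)⁻¹ ^ p) *
        levelInt μ p k (f - g : Lp ℝ (q : ℝ≥0∞) μ) := by
  have h1 : 0 < 1 - ω * h := by linarith
  have h2 := hA _ (by positivity) _ _ _ _ (addScalar_resolventRel hωh hu)
    (addScalar_resolventRel hωh hw) _
    (ofReal_pos_part_rpow_mem_J₀ (k := (1 - ω * h)⁻¹ * k) hp (by positivity))
  rw [← levelInt_const_mul (by positivity)]
  refine (levelInt_congr (Lp.coeFn_sub u w)).trans_le (h2.trans_eq ?_)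
  refine levelInt_congr (f := fun x => ((1 - ω * h)⁻¹ • f : Lp ℝ (q : ℝ≥0∞) μ) x -
    ((1 - ω * h)⁻¹ • g : Lp ℝ (q : ℝ≥0∞) μ) x) ?_
  filter_upwards [Lp.coeFn_smul (1 - ω * h)⁻¹ f, Lp.coeFn_smul (1 - ω * h)⁻¹ g,
    Lp.coeFn_sub f g] with x e1 e2 e3
  rw [e1, e2, e3]
  simp [mul_sub]

theorem Operator.eLpNorm_resolventRel_le (hA : (A.addScalar ω).CompletelyAccretive)
    {h : ℝ} (hh : 0 < h) (hωh : ω * h < 1) {f g u w : Lp ℝ (q : ℝ≥0∞) μ}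
    (hu : A.ResolventRel h f u) (hw : A.ResolventRel h g w) {p : ℝ≥0∞} (hp : 1 ≤ p) :
    eLpNorm (u - w : Lp ℝ (q : ℝ≥0∞) μ) p μ ≤
      ENNReal.ofReal (1 - ω * h)⁻¹ * eLpNorm (f - g : Lp ℝ (q : ℝ≥0∞) μ) p μ := by
  have h1 : 0 < 1 - ω * h := by linarith
  exact eLpNorm_le_of_levelInt_le (by positivity) (Lp.aestronglyMeasurable _)
    (Lp.aestronglyMeasurable _)
    (fun p k hp hk => levelInt_resolventRel_le hA hh hωh hu hw hp hk) hp

theorem Operator.norm_resolventRel_le (hA : (A.addScalar ω).CompletelyAccretive)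
    {h : ℝ} (hh : 0 < h) (hωh : ω * h < 1) {f g u w : Lp ℝ (q : ℝ≥0∞) μ}
    (hu : A.ResolventRel h f u) (hw : A.ResolventRel h g w) :
    ‖u - w‖ ≤ (1 - ω * h)⁻¹ * ‖f - g‖ := by
  have h1 := ENNReal.toReal_mono (ENNReal.mul_ne_top ENNReal.ofReal_ne_top (Lp.eLpNorm_ne_top _))
    (eLpNorm_resolventRel_le hA hh hωh hu hw (Fact.out : 1 ≤ (q : ℝ≥0∞)))
  rwa [ENNReal.toReal_mul, ENNReal.toReal_ofReal (inv_nonneg.2 (by linarith)),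
    ← Lp.norm_def, ← Lp.norm_def] at h1

theorem Operator.MCompletelyAccretive.exists_resolventRel
    (hA : (A.addScalar ω).MCompletelyAccretive) {h : ℝ} (hh : 0 < h) (hωh : ω * h < 1)
    (f : Lp ℝ (q : ℝ≥0∞) μ) : ∃ u, A.ResolventRel h f u := by
  have h1 : 0 < 1 - ω * h := by linarith
  obtain ⟨hacc, l₀, hl₀, hr⟩ := hA
  have hzero : ((A.addScalar ω).addScalar 0) = A.addScalar ω := by
    ext ⟨u, v⟩
    simp [Operator.addScalar]
  have hB : ∀ ⦃u v u' v' : Lp ℝ (q : ℝ≥0∞) μ⦄, (u, v) ∈ A.addScalar ω →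
      (u', v') ∈ A.addScalar ω → ∀ l : ℝ, 0 < l → ‖u - u'‖ ≤ ‖u - u' + l • (v - v')‖ := by
    intro u v u' v' huv huv' l hl
    have := norm_resolventRel_le (A := A.addScalar ω) (ω := 0) (by rwa [hzero]) hl (by simp)
      (⟨v, huv, rfl⟩ : (A.addScalar ω).ResolventRel l (u + l • v) u)
      (⟨v', huv', rfl⟩ : (A.addScalar ω).ResolventRel l (u' + l • v') u')
    simp only [zero_mul, sub_zero, inv_one, one_mul] at this
    refine this.trans_eq ?_
    congr 1
    rw [smul_sub]; abel
  obtain ⟨u, v, ⟨v', hv', hv⟩, hf⟩ := range_of_accretive hB hl₀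
    (show 0 < h / (1 - ω * h) by positivity)
    (fun f => by obtain ⟨u, v, huv⟩ := hr f; exact ⟨u, v, huv⟩) ((1 - ω * h)⁻¹ • f)
  refine ⟨u, v', hv', ?_⟩
  simp only at hv hv'
  have h2 : f = (1 - ω * h) • (u + (h / (1 - ω * h)) • v) := by
    rw [hf, smul_smul, mul_inv_cancel₀ h1.ne', one_smul]
  have h3 : 1 - h * ω ≠ 0 := by linarith [mul_comm ω h]
  rw [h2, hv]
  match_scalars <;> field_simp
  ring

theorem Operator.MCompletelyAccretive.resolventRel_resolvent
    (hA : (A.addScalar ω).MCompletelyAccretive) {h : ℝ} (hh : 0 < h) (hωh : ω * h < 1)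
    (f : Lp ℝ (q : ℝ≥0∞) μ) : A.ResolventRel h f (A.resolvent h f) := by
  have := hA.exists_resolventRel hh hωh f
  rw [Operator.resolvent, dif_pos this]
  exact this.choose_spec

theorem Operator.MCompletelyAccretive.isResolventFamily
    (hA : (A.addScalar ω).MCompletelyAccretive) (hω : 0 ≤ ω) :
    IsResolventFamily A ω A.resolvent where
  omega_nonneg := hω
  accretive := by
    intro u v u' v' huv huv' δ hδ hωδ
    have := norm_resolventRel_le hA.1 hδ hωδ
      (⟨v, huv, rfl⟩ : A.ResolventRel δ (u + δ • v) u)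
      (⟨v', huv', rfl⟩ : A.ResolventRel δ (u' + δ • v') u')
    rw [inv_mul_eq_div, le_div_iff₀ (by linarith)] at this
    rw [mul_comm]
    refine this.trans_eq ?_
    congr 1
    rw [smul_sub]; abel
  resolvent l hl hωl f := hA.resolventRel_resolvent hl hωl f

theorem Operator.MCompletelyAccretive.levelInt_iterate_le
    (hA : (A.addScalar ω).MCompletelyAccretive) {h : ℝ} (hh : 0 < h) (hωh : ω * h < 1)
    (f g : Lp ℝ (q : ℝ≥0∞) μ) {p k : ℝ} (hp : 1 ≤ p) (hk : 0 ≤ k) (n : ℕ) :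
    levelInt μ p ((1 - ω * h)⁻¹ ^ n * k)
        ((A.resolvent h)^[n] f - (A.resolvent h)^[n] g : Lp ℝ (q : ℝ≥0∞) μ) ≤
      ENNReal.ofReal (((1 - ω * h)⁻¹ ^ n) ^ p) *
        levelInt μ p k (f - g : Lp ℝ (q : ℝ≥0∞) μ) := by
  have h1 : 0 < (1 - ω * h)⁻¹ := inv_pos.2 (by linarith)
  induction n with
  | zero => simp
  | succ n ih =>
    rw [Function.iterate_succ_apply', Function.iterate_succ_apply', pow_succ', mul_assoc]
    refine (levelInt_resolventRel_le hA.1 hh hωh (hA.resolventRel_resolvent hh hωh _)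
      (hA.resolventRel_resolvent hh hωh _) hp (by positivity)).trans ?_
    rw [Real.mul_rpow h1.le (by positivity), ENNReal.ofReal_mul (by positivity), mul_assoc]
    gcongr

theorem Operator.MCompletelyAccretive.eLpNorm_iterate_le
    (hA : (A.addScalar ω).MCompletelyAccretive) {h : ℝ} (hh : 0 < h) (hωh : ω * h < 1)
    (f g : Lp ℝ (q : ℝ≥0∞) μ) {p : ℝ≥0∞} (hp : 1 ≤ p) (n : ℕ) :
    eLpNorm ((A.resolvent h)^[n] f - (A.resolvent h)^[n] g : Lp ℝ (q : ℝ≥0∞) μ) p μ ≤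
      ENNReal.ofReal ((1 - ω * h)⁻¹ ^ n) * eLpNorm (f - g : Lp ℝ (q : ℝ≥0∞) μ) p μ := by
  have h1 : 0 < (1 - ω * h)⁻¹ := inv_pos.2 (by linarith)
  exact eLpNorm_le_of_levelInt_le (by positivity) (Lp.aestronglyMeasurable _)
    (Lp.aestronglyMeasurable _) (fun p k hp hk => hA.levelInt_iterate_le hh hωh f g hp hk n) hp

end Resolvent

end NonlinearSemigroup

namespace NonlinearSemigroup

variable {Ω : Type*} [MeasurableSpace Ω] {μ : Measure Ω} {q : ℝ≥0} [Fact (1 ≤ (q : ℝ≥0∞))]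
  {A : Operator q μ} {ω : ℝ}

theorem one_le_coe_of_fact (q : ℝ≥0) [Fact (1 ≤ (q : ℝ≥0∞))] : (1 : ℝ) ≤ q := by
  have h : (1 : ℝ≥0∞) ≤ q := Fact.out
  exact_mod_cast h

/-! ### Lower semicontinuity along `L^q` limits. -/

section LowerSemicontinuity

theorem exists_subseq_tendsto_ae {f : ℕ → Lp ℝ (q : ℝ≥0∞) μ} {g : Lp ℝ (q : ℝ≥0∞) μ}
    (hf : Tendsto f atTop (𝓝 g)) : ∃ ns : ℕ → ℕ, StrictMono ns ∧
      ∀ᵐ x ∂μ, Tendsto (fun i => f (ns i) x) atTop (𝓝 (g x)) :=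
  (tendstoInMeasure_of_tendsto_Lp hf).exists_seq_tendsto_ae

/-- Fatou's lemma along an a.e. convergent subsequence. The level `k n` must be allowed to move,
since for the approximants it carries the factor `(1 - ω t/n)⁻ⁿ`. -/
theorem levelInt_le_of_tendsto {f : ℕ → Lp ℝ (q : ℝ≥0∞) μ} {g : Lp ℝ (q : ℝ≥0∞) μ}
    (hf : Tendsto f atTop (𝓝 g)) {k : ℕ → ℝ} {k₀ : ℝ} (hk : Tendsto k atTop (𝓝 k₀))
    {a : ℕ → ℝ≥0∞} {a₀ : ℝ≥0∞} (ha : Tendsto a atTop (𝓝 a₀)) {p : ℝ} (hp : 0 ≤ p)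
    (h : ∀ᶠ n in atTop, levelInt μ p (k n) (f n) ≤ a n) : levelInt μ p k₀ g ≤ a₀ := by
  obtain ⟨ns, hns, hae⟩ := exists_subseq_tendsto_ae hf
  have hns' := hns.tendsto_atTop
  calc levelInt μ p k₀ g
      = ∫⁻ x, liminf (fun i => ENNReal.ofReal (max (|f (ns i) x| - k (ns i)) 0 ^ p)) atTop ∂μ := by
        refine lintegral_congr_ae (hae.mono fun x hx => ?_)
        refine (Tendsto.liminf_eq ?_).symm
        refine ENNReal.tendsto_ofReal ?_
        exact ((hx.abs.sub (hk.comp hns')).max tendsto_const_nhds).rpow_const (Or.inr hp)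
    _ ≤ liminf (fun i => levelInt μ p (k (ns i)) (f (ns i))) atTop := by
        refine lintegral_liminf_le' fun i => ?_
        have := (Lp.aestronglyMeasurable (f (ns i))).aemeasurable
        fun_prop
    _ ≤ liminf (fun i => a (ns i)) atTop := liminf_le_liminf (hns'.eventually h)
    _ = a₀ := (ha.comp hns').liminf_eq

theorem eLpNorm_le_of_tendsto {f : ℕ → Lp ℝ (q : ℝ≥0∞) μ} {g : Lp ℝ (q : ℝ≥0∞) μ}
    (hf : Tendsto f atTop (𝓝 g)) {a : ℕ → ℝ≥0∞} {a₀ : ℝ≥0∞} (ha : Tendsto a atTop (𝓝 a₀))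
    {p : ℝ≥0∞} (h : ∀ᶠ n in atTop, eLpNorm (f n) p μ ≤ a n) : eLpNorm g p μ ≤ a₀ := by
  obtain ⟨ns, hns, hae⟩ := exists_subseq_tendsto_ae hf
  have hns' := hns.tendsto_atTop
  calc eLpNorm g p μ ≤ liminf (fun i => eLpNorm (f (ns i)) p μ) atTop :=
        Lp.eLpNorm_lim_le_liminf_eLpNorm (fun i => Lp.aestronglyMeasurable _) _ hae
    _ ≤ liminf (fun i => a (ns i)) atTop := liminf_le_liminf (hns'.eventually h)
    _ = a₀ := (ha.comp hns').liminf_eq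

end LowerSemicontinuity

/-! ### Growth bounds for the semigroup. -/

section Semigroup

theorem Operator.tendsto_expApprox (hA : (A.addScalar ω).MCompletelyAccretive) (hω : 0 ≤ ω)
    (hd : Dense A.domain) {t : ℝ} (ht : 0 < t) (u : Lp ℝ (q : ℝ≥0∞) μ) :
    Tendsto (A.expApprox t u) atTop (𝓝 (A.semigroup t u)) := by
  have h1 := (hA.isResolventFamily hω).cauchySeq_of_mem_closure ht (u := u)
    (by rw [show {u | ∃ v, (u, v) ∈ A} = A.domain from rfl, hd.closure_eq]; trivial)
  rw [Operator.semigroup, if_neg ht.ne']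
  exact tendsto_nhds_limUnder (cauchySeq_tendsto_of_complete h1)

/-- Every later splitting of time is dyadic, so this doubling law replaces the full semigroup law.
-/
theorem Operator.semigroup_two_mul (hA : (A.addScalar ω).MCompletelyAccretive) (hω : 0 ≤ ω)
    (hd : Dense A.domain) {t : ℝ} (ht : 0 < t) (u : Lp ℝ (q : ℝ≥0∞) μ) :
    A.semigroup (2 * t) u = A.semigroup t (A.semigroup t u) := by
  have h1 := (hA.isResolventFamily hω).tendsto_two_mul ht (tendsto_expApprox hA hω hd ht u)
    (tendsto_expApprox hA hω hd ht (A.semigroup t u))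
  have h2 : Tendsto (fun n : ℕ => 2 * n) atTop atTop :=
    tendsto_id.const_mul_atTop' (by norm_num)
  exact tendsto_nhds_unique
    ((tendsto_expApprox hA hω hd (show 0 < 2 * t by positivity) u).comp h2) h1

theorem tendsto_inv_one_sub_mul_pow (ω t : ℝ) :
    Tendsto (fun n : ℕ => (1 - ω * (t / n))⁻¹ ^ n) atTop (𝓝 (Real.exp (ω * t))) := by
  simpa only [mul_div_assoc] using tendsto_inv_one_sub_pow (ω * t)

/-- The semigroup contracts the level integrals, up to the factor `exp (ω t)`. -/
theorem Operator.levelInt_semigroup_le (hA : (A.addScalar ω).MCompletelyAccretive) (hω : 0 ≤ ω)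
    (hd : Dense A.domain) {t : ℝ} (ht : 0 < t) (u w : Lp ℝ (q : ℝ≥0∞) μ) {p k : ℝ} (hp : 1 ≤ p)
    (hk : 0 ≤ k) :
    levelInt μ p (Real.exp (ω * t) * k)
        (A.semigroup t u - A.semigroup t w : Lp ℝ (q : ℝ≥0∞) μ) ≤
      ENNReal.ofReal (Real.exp (ω * t) ^ p) * levelInt μ p k (u - w : Lp ℝ (q : ℝ≥0∞) μ) := by
  have hc := tendsto_inv_one_sub_mul_pow ω t
  refine levelInt_le_of_tendsto ((tendsto_expApprox hA hω hd ht u).sub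
    (tendsto_expApprox hA hω hd ht w)) (hc.mul_const k)
    (a := fun n : ℕ => ENNReal.ofReal (((1 - ω * (t / n))⁻¹ ^ n) ^ p) *
      levelInt μ p k (u - w : Lp ℝ (q : ℝ≥0∞) μ)) ?_ (by linarith) ?_
  · refine ENNReal.Tendsto.mul_const (ENNReal.tendsto_ofReal
      (hc.rpow_const (Or.inr (by linarith)))) (Or.inl ?_)
    rw [Ne, ENNReal.ofReal_eq_zero, not_le]
    positivity
  · filter_upwards [eventually_two_mul_le (ω * t)] with n hn
    have hn' : (0 : ℝ) < n := by exact_mod_cast hn.2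
    exact hA.levelInt_iterate_le (by positivity) (mul_div_lt_one hn.1 hn.2) u w hp hk n

theorem Operator.eLpNorm_semigroup_le (hA : (A.addScalar ω).MCompletelyAccretive) (hω : 0 ≤ ω)
    (hd : Dense A.domain) {t : ℝ} (ht : 0 < t) (u w : Lp ℝ (q : ℝ≥0∞) μ) {p : ℝ≥0∞}
    (hp : 1 ≤ p) :
    eLpNorm (A.semigroup t u - A.semigroup t w : Lp ℝ (q : ℝ≥0∞) μ) p μ ≤
      ENNReal.ofReal (Real.exp (ω * t)) * eLpNorm (u - w : Lp ℝ (q : ℝ≥0∞) μ) p μ :=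
  eLpNorm_le_of_levelInt_le (Real.exp_pos _) (Lp.aestronglyMeasurable _)
    (Lp.aestronglyMeasurable _)
    (fun _ _ hp hk => levelInt_semigroup_le hA hω hd ht u w hp hk) hp

theorem Operator.iterate_resolvent_equilibrium (hA : (A.addScalar ω).MCompletelyAccretive)
    (hω : 0 ≤ ω) {u₀ : Lp ℝ (q : ℝ≥0∞) μ} (h0 : (u₀, 0) ∈ A) {h : ℝ} (hh : 0 < h)
    (hωh : ω * h < 1) (n : ℕ) : (A.resolvent h)^[n] u₀ = u₀ := by
  have h1 := (hA.isResolventFamily hω).apply_eq hh hωh h0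
  rw [smul_zero, add_zero] at h1
  exact Function.iterate_fixed h1 n

theorem Operator.semigroup_equilibrium (hA : (A.addScalar ω).MCompletelyAccretive) (hω : 0 ≤ ω)
    (hd : Dense A.domain) {u₀ : Lp ℝ (q : ℝ≥0∞) μ} (h0 : (u₀, 0) ∈ A) {t : ℝ} (ht : 0 < t) :
    A.semigroup t u₀ = u₀ := by
  refine tendsto_nhds_unique (tendsto_expApprox hA hω hd ht u₀)
    (tendsto_const_nhds.congr' ?_)
  filter_upwards [eventually_two_mul_le (ω * t)] with n hn
  have hn' : (0 : ℝ) < n := by exact_mod_cast hn.2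
  exact (iterate_resolvent_equilibrium hA hω h0 (by positivity)
    (mul_div_lt_one hn.1 hn.2) n).symm

end Semigroup

/-! ### The `L^q`-`L^r` regularization, part (1). -/

section Regularization

/-- The `q`-bracket is at most each difference quotient, by convexity. -/
theorem qBracket_le (u v : Lp ℝ (q : ℝ≥0∞) μ) {h : ℝ} (hh : 0 < h) :
    qBracket u v ≤ (‖u + h • v‖ ^ (q : ℝ) - ‖u‖ ^ (q : ℝ)) / (q * h) := by
  have hq := one_le_coe_of_fact q
  refine le_of_tendsto (tendsto_qBracket u v) ?_
  filter_upwards [Ioc_mem_nhdsGT hh] with l hl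
  have hl0 : 0 < l := hl.1
  have hs : l / h ≤ 1 := (div_le_one hh).2 hl.2
  have hs0 : 0 ≤ l / h := by positivity
  have h1 : ‖u + l • v‖ ≤ (1 - l / h) * ‖u‖ + l / h * ‖u + h • v‖ := by
    have : u + l • v = (1 - l / h) • u + (l / h) • (u + h • v) := by
      match_scalars <;> field_simp
      ring
    rw [this]
    refine (norm_add_le _ _).trans_eq ?_
    rw [norm_smul, norm_smul, Real.norm_of_nonneg (by linarith), Real.norm_of_nonneg hs0]
  have h2 := (convexOn_rpow hq).2 (Set.mem_Ici.2 (norm_nonneg u))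
    (Set.mem_Ici.2 (norm_nonneg (u + h • v))) (show 0 ≤ 1 - l / h by linarith) hs0 (by ring)
  have h3 := (Real.rpow_le_rpow (norm_nonneg _) h1 (by linarith)).trans h2
  simp only [smul_eq_mul] at h3
  have e : 1 / (q : ℝ) * ‖u + l • v‖ ^ (q : ℝ) - 1 / (q : ℝ) * ‖u‖ ^ (q : ℝ) ≤
      1 / (q : ℝ) * (l / h * (‖u + h • v‖ ^ (q : ℝ) - ‖u‖ ^ (q : ℝ))) := by
    rw [← mul_sub]
    refine mul_le_mul_of_nonneg_left ?_ (by positivity)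
    linarith
  rw [div_le_iff₀ hl0]
  refine e.trans_eq ?_
  field_simp

theorem one_add_mul_le_inv_one_sub_rpow {x p : ℝ} (hx1 : x < 1) (hp : 0 ≤ p) :
    1 + p * x ≤ (1 - x)⁻¹ ^ p := by
  have h1 : Real.exp x ≤ (1 - x)⁻¹ := by
    rw [le_inv_comm₀ (Real.exp_pos _) (by linarith), ← Real.exp_neg]
    have := Real.add_one_le_exp (-x)
    linarith
  calc 1 + p * x ≤ Real.exp (p * x) := by rw [add_comm]; exact Real.add_one_le_exp _
    _ = Real.exp x ^ p := by rw [← Real.exp_mul, mul_comm]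
    _ ≤ _ := Real.rpow_le_rpow (Real.exp_pos _).le h1 hp

/-- Discrete smoothing estimate for the implicit Euler scheme. -/
theorem Operator.Setting.euler_estimate {r : ℝ≥0∞} (hr : 1 ≤ r) {ρ σ C : ℝ} (hρ : 0 ≤ ρ)
    (hσ : 0 < σ) (hC : 0 < C) {u₀ : Lp ℝ (q : ℝ≥0∞) μ} (hS : A.Setting r ρ σ ω C u₀)
    {h : ℝ} (hh : 0 < h) (hωh : ω * h < 1) (u : Lp ℝ (q : ℝ≥0∞) μ) {n : ℕ} (hn : 0 < n) :
    eLpNorm ((A.resolvent h)^[n] u - u₀ : Lp ℝ (q : ℝ≥0∞) μ) r μ ≠ ∞ ∧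
    n * h * (eLpNorm ((A.resolvent h)^[n] u - u₀ : Lp ℝ (q : ℝ≥0∞) μ) r μ).toReal ^ σ ≤
      C / q * ((1 - ω * h)⁻¹ ^ (n + 1)) ^ (σ + ρ + q) * ‖u - u₀‖ ^ (q + ρ) := by
  have hA := hS.mCompletelyAccretive
  have hω := hS.omega_nonneg
  have hfix := fun i => iterate_resolvent_equilibrium hA hω hS.equilibrium hh hωh i
  have hq := one_le_coe_of_fact q
  have hq0 : (0 : ℝ) < q := by linarith
  set U : ℕ → Lp ℝ (q : ℝ≥0∞) μ := fun i => (A.resolvent h)^[i] u with hU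
  set a : ℕ → ℝ := fun i => ‖U i - u₀‖ with ha
  set c := (1 - ω * h)⁻¹ with hc
  have hωh0 : 0 ≤ ω * h := mul_nonneg hω hh.le
  have hc1 : 1 ≤ c := by
    rw [hc, one_le_inv₀ (by linarith)]; linarith
  set E := c ^ (n + 1) with hE
  have hE1 : 1 ≤ E := one_le_pow₀ hc1
  have ha0 : ∀ i, a i ≤ c ^ i * a 0 := fun i => by
    have := (hA.isResolventFamily hω).norm_iterate_sub_le hh hωh u u₀ i
    rwa [hfix] at this
  have hann : ∀ i, 0 ≤ a i := fun i => norm_nonneg _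
  set e : ℕ → ℝ≥0∞ := fun i => eLpNorm (U i - u₀ : Lp ℝ (q : ℝ≥0∞) μ) r μ with he
  have hrel : ∀ i, ∃ v, (U (i + 1), v) ∈ A ∧ U (i + 1) + h • v = U i := fun i => by
    have := hA.resolventRel_resolvent hh hωh (U i)
    rwa [show A.resolvent h (U i) = U (i + 1) from
      (Function.iterate_succ_apply' (A.resolvent h) i u).symm] at this
  have hfin : ∀ i, e (i + 1) ≠ ∞ := fun i => by
    obtain ⟨v, hv, -⟩ := hrel i
    exact (hS.gagliardoNirenberg _ _ hv).1.eLpNorm_ne_top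
  -- The subtracted geometric term compensates the growth `ω q h a (i + 1) ^ q` at each step, which
  -- makes the sum telescope.
  set G : ℕ → ℝ := fun i => a i ^ (q : ℝ) - a 0 ^ (q : ℝ) * (c ^ (i + 1)) ^ (q : ℝ) with hG
  have hstep : ∀ i < n, h * (e n).toReal ^ σ ≤
      E ^ σ * (C / q) * (E * a 0) ^ ρ * (G i - G (i + 1)) := by
    intro i hi
    obtain ⟨v, hv, hvU⟩ := hrel i
    have h1 := (hS.gagliardoNirenberg _ _ hv).2
    -- Taking the difference quotient with the Euler step `h` itself turns `u + h v` into the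
    -- previous iterate.
    have h2 := qBracket_le (U (i + 1) - u₀) v hh
    have h3 : U (i + 1) - u₀ + h • v = U i - u₀ := by rw [← hvU]; abel
    rw [h3] at h2
    set Y := a i ^ (q : ℝ) - a (i + 1) ^ (q : ℝ) + ω * q * h * a (i + 1) ^ (q : ℝ) with hY
    have h4 : h * (e (i + 1)).toReal ^ σ ≤ C / q * Y * a (i + 1) ^ ρ := by
      have h5 : h * (qBracket (U (i + 1) - u₀) v + ω * a (i + 1) ^ (q : ℝ)) ≤ Y / q := by
        rw [le_div_iff₀ hq0]
        rw [le_div_iff₀ (by positivity)] at h2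
        simp only [hY, ha]
        linarith
      calc h * (e (i + 1)).toReal ^ σ ≤ h * _ := mul_le_mul_of_nonneg_left h1 hh.le
        _ = C * (h * (qBracket (U (i + 1) - u₀) v + ω * a (i + 1) ^ (q : ℝ))) *
            a (i + 1) ^ ρ := by simp only [ha]; ring
        _ ≤ C * (Y / q) * a (i + 1) ^ ρ := by
            have := Real.rpow_nonneg (hann (i + 1)) ρ
            gcongr
        _ = _ := by ring
    -- The sign is needed to enlarge the factor `a (i + 1) ^ ρ` later. If `a (i + 1) > 0`, a
    -- negative `Y` would contradict `h4`; if `a (i + 1) = 0`, then `Y = a i ^ q`.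
    have hY0 : 0 ≤ Y := by
      by_contra! hneg
      rcases (hann (i + 1)).eq_or_lt with h0 | h0
      · rw [hY, ← h0, Real.zero_rpow hq0.ne', mul_zero, sub_zero, add_zero] at hneg
        exact absurd hneg (not_lt.2 (Real.rpow_nonneg (hann i) _))
      · have h6 : C / q * Y * a (i + 1) ^ ρ < 0 :=
          mul_neg_of_neg_of_pos (mul_neg_of_pos_of_neg (by positivity) hneg)
            (Real.rpow_pos_of_pos h0 _)
        have : 0 ≤ h * (e (i + 1)).toReal ^ σ := by positivity
        linarith
    have h5 : a (i + 1) ≤ E * a 0 := (ha0 (i + 1)).trans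
      (mul_le_mul_of_nonneg_right (pow_le_pow_right₀ hc1 (by omega)) (hann 0))
    have h6 : Y ≤ G i - G (i + 1) := by
      have e1 : a (i + 1) ^ (q : ℝ) ≤ (c ^ (i + 1)) ^ (q : ℝ) * a 0 ^ (q : ℝ) := by
        rw [← Real.mul_rpow (by positivity) (hann 0)]
        exact Real.rpow_le_rpow (hann _) (ha0 _) hq0.le
      have e2 := one_add_mul_le_inv_one_sub_rpow hωh hq0.le
      rw [← hc] at e2
      have e3 : (c ^ (i + 1 + 1)) ^ (q : ℝ) = c ^ (q : ℝ) * (c ^ (i + 1)) ^ (q : ℝ) := by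
        rw [pow_succ' c (i + 1), Real.mul_rpow (by positivity) (by positivity)]
      have e4 : ω * q * h * a (i + 1) ^ (q : ℝ) ≤
          (c ^ (q : ℝ) - 1) * ((c ^ (i + 1)) ^ (q : ℝ) * a 0 ^ (q : ℝ)) := by
        refine mul_le_mul ?_ e1 (Real.rpow_nonneg (hann _) _) ?_
        · linarith
        · have : 0 ≤ q * (ω * h) := by positivity
          linarith
      simp only [hG, hY]
      rw [e3]
      linarith
    -- The `r`-norm is almost decreasing along the scheme, so the last one bounds every summand from
    -- below.
    have h7 : (e n).toReal ≤ E * (e (i + 1)).toReal := by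
      have f1 := hA.eLpNorm_iterate_le hh hωh (U (i + 1)) u₀ hr (n - (i + 1))
      rw [hfix, ← Function.iterate_add_apply, Nat.sub_add_cancel (by omega)] at f1
      have f2 := ENNReal.toReal_mono (ENNReal.mul_ne_top ENNReal.ofReal_ne_top (hfin i)) f1
      rw [ENNReal.toReal_mul, ENNReal.toReal_ofReal (by positivity)] at f2
      refine f2.trans ?_
      exact mul_le_mul_of_nonneg_right (pow_le_pow_right₀ hc1 (by omega)) ENNReal.toReal_nonneg
    calc h * (e n).toReal ^ σ ≤ h * (E * (e (i + 1)).toReal) ^ σ := by gcongr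
      _ = E ^ σ * (h * (e (i + 1)).toReal ^ σ) := by
          rw [Real.mul_rpow (by positivity) ENNReal.toReal_nonneg]; ring
      _ ≤ E ^ σ * (C / q * Y * a (i + 1) ^ ρ) := by gcongr
      _ ≤ E ^ σ * (C / q * (G i - G (i + 1)) * (E * a 0) ^ ρ) := by
          have := Real.rpow_le_rpow (hann _) h5 hρ
          have := Real.rpow_nonneg (hann (i + 1)) ρ
          have : 0 ≤ G i - G (i + 1) := hY0.trans h6
          gcongr
      _ = _ := by ring
  constructor
  · obtain ⟨m, rfl⟩ := Nat.exists_eq_succ_of_ne_zero hn.ne'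
    exact hfin m
  have hsum : ∑ i ∈ Finset.range n, h * (e n).toReal ^ σ ≤
      ∑ i ∈ Finset.range n, E ^ σ * (C / q) * (E * a 0) ^ ρ * (G i - G (i + 1)) :=
    Finset.sum_le_sum fun i hi => hstep i (Finset.mem_range.1 hi)
  rw [Finset.sum_const, Finset.card_range, nsmul_eq_mul, ← Finset.mul_sum,
    Finset.sum_range_sub'] at hsum
  have hG0 : G 0 - G n ≤ E ^ (q : ℝ) * a 0 ^ (q : ℝ) := by
    simp only [hG]
    have f1 : (1 : ℝ) ≤ (c ^ (0 + 1)) ^ (q : ℝ) := Real.one_le_rpow (one_le_pow₀ hc1) hq0.le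
    have f2 : 0 ≤ a 0 ^ (q : ℝ) := Real.rpow_nonneg (hann 0) _
    have f3 : 0 ≤ a n ^ (q : ℝ) := Real.rpow_nonneg (hann n) _
    nlinarith
  have hE0 : 0 < E := by linarith
  calc n * h * (e n).toReal ^ σ = n * (h * (e n).toReal ^ σ) := by ring
    _ ≤ _ := hsum
    _ ≤ E ^ σ * (C / q) * (E * a 0) ^ ρ * (E ^ (q : ℝ) * a 0 ^ (q : ℝ)) := by
        have := hann 0
        gcongr
    _ = C / q * E ^ (σ + ρ + q) * a 0 ^ (q + ρ) := by
        rw [Real.mul_rpow hE0.le (hann 0), Real.rpow_add hE0, Real.rpow_add hE0,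
          Real.rpow_add_of_nonneg (hann 0) hq0.le hρ]
        ring

/-- The `L^q`-`L^r` regularization estimate. -/
theorem Operator.Setting.eLpNorm_semigroup_sub_le {r : ℝ≥0∞} (hr : 1 ≤ r) {ρ σ C : ℝ}
    (hρ : 0 ≤ ρ) (hσ : 0 < σ) (hC : 0 < C) {u₀ : Lp ℝ (q : ℝ≥0∞) μ}
    (hS : A.Setting r ρ σ ω C u₀) {t : ℝ} (ht : 0 < t) (u : Lp ℝ (q : ℝ≥0∞) μ) :
    eLpNorm (A.semigroup t u - u₀ : Lp ℝ (q : ℝ≥0∞) μ) r μ ≤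
      ENNReal.ofReal ((C / q) ^ (1 / σ) * t ^ (-(1 / σ)) *
        Real.exp (ω * (gam q ρ σ + 1) * t) * ‖u - u₀‖ ^ gam q ρ σ) := by
  have hA := hS.mCompletelyAccretive
  have hω := hS.omega_nonneg
  have hq := one_le_coe_of_fact q
  have hq0 : (0 : ℝ) < q := by linarith
  set a := ‖u - u₀‖ with ha
  have ha0 : 0 ≤ a := norm_nonneg _
  set E : ℕ → ℝ := fun n => (1 - ω * (t / n))⁻¹ ^ (n + 1) with hE
  have hElim : Tendsto E atTop (𝓝 (Real.exp (ω * t))) := by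
    have h1 : Tendsto (fun n : ℕ => (1 - ω * (t / n))⁻¹) atTop (𝓝 (1 - ω * 0)⁻¹) :=
      ((tendsto_const_div_atTop_nhds_zero_nat t).const_mul ω).const_sub 1 |>.inv₀ (by simp)
    have := (tendsto_inv_one_sub_mul_pow ω t).mul h1
    simpa [hE, pow_succ] using this
  set F : ℕ → ℝ := fun n => (C / q * E n ^ (σ + ρ + q) * a ^ (q + ρ) / t) ^ (1 / σ) with hF
  have hFlim : Tendsto F atTop (𝓝 ((C / q) ^ (1 / σ) * t ^ (-(1 / σ)) *
        Real.exp (ω * (gam q ρ σ + 1) * t) * a ^ gam q ρ σ)) := by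
    have h1 : Tendsto F atTop
        (𝓝 ((C / q * Real.exp (ω * t) ^ (σ + ρ + q) * a ^ (q + ρ) / t) ^ (1 / σ))) := by
      refine Tendsto.rpow_const ?_ (Or.inr (by positivity))
      refine ((Tendsto.const_mul _ ?_).mul_const _).div_const _
      exact hElim.rpow_const (Or.inr (by positivity))
    convert h1 using 2
    have hCq : 0 ≤ C / q := by positivity
    rw [div_eq_mul_inv _ t, Real.mul_rpow (by positivity) (by positivity),
      Real.mul_rpow (by positivity) (by positivity), Real.mul_rpow hCq (by positivity),
      ← Real.rpow_mul ha0, ← Real.rpow_mul (Real.exp_pos _).le, ← Real.exp_mul,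
      Real.inv_rpow ht.le, ← Real.rpow_neg ht.le]
    have e1 : (q + ρ) * (1 / σ) = gam q ρ σ := by rw [gam]; ring
    have e2 : ω * t * ((σ + ρ + q) * (1 / σ)) = ω * (gam q ρ σ + 1) * t := by
      rw [gam]; field_simp; ring
    rw [e1, e2]
    ring
  refine eLpNorm_le_of_tendsto ((tendsto_expApprox hA hω hS.dense_domain ht u).sub_const u₀)
    (ENNReal.tendsto_ofReal hFlim) ?_
  filter_upwards [eventually_two_mul_le (ω * t)] with n hn
  have hn' : (0 : ℝ) < n := by exact_mod_cast hn.2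
  obtain ⟨h1, h2⟩ := hS.euler_estimate hr hρ hσ hC (show 0 < t / n by positivity)
    (mul_div_lt_one hn.1 hn.2) u hn.2
  rw [← ENNReal.ofReal_toReal (show eLpNorm (A.expApprox t u n - u₀ : Lp ℝ (q : ℝ≥0∞) μ) r μ ≠ ∞
    from h1)]
  refine ENNReal.ofReal_le_ofReal ?_
  rw [mul_div_cancel₀ t hn'.ne'] at h2
  have h3 : 0 ≤ E n := by
    have := mul_div_lt_one hn.1 hn.2
    exact pow_nonneg (inv_nonneg.2 (by linarith)) _
  simp only [hF]
  rw [one_div, Real.le_rpow_inv_iff_of_pos ENNReal.toReal_nonneg (by positivity) hσ,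
    le_div_iff₀ ht, mul_comm]
  exact h2

end Regularization

end NonlinearSemigroup

namespace NonlinearSemigroup

/-! ### Real-variable lemmas for the De Giorgi iteration. -/

section DeGiorgi

/-- De Giorgi's lemma on fast geometric convergence. -/
theorem tendsto_zero_of_fast_recursion {F : ℕ → ℝ≥0∞} {Γ x κ b : ℝ} (hΓ : 0 ≤ Γ) (hx : 0 < x)
    (hκ : 1 < κ) (hb : 0 < b)
    (hF : ∀ n, F (n + 1) ≤ ENNReal.ofReal (Γ * ((2 : ℝ) ^ n) ^ b) * F n ^ κ)
    (h0 : F 0 ≤ ENNReal.ofReal x) (hsmall : Γ * x ^ (κ - 1) ≤ 2 ^ (-(b / (κ - 1)))) :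
    Tendsto F atTop (𝓝 0) := by
  have hκ1 : 0 < κ - 1 := by linarith
  -- The ratio with `d ^ (κ - 1) = 2 ^ (-b)`: geometric decay at rate `d` exactly cancels the growth
  -- `2 ^ (n b)`.
  set d : ℝ := 2 ^ (-(b / (κ - 1))) with hd
  have hd0 : 0 < d := by positivity
  have hd1 : d < 1 := Real.rpow_lt_one_of_one_lt_of_neg one_lt_two (neg_lt_zero.2 (by positivity))
  have hmain : ∀ n, F n ≤ ENNReal.ofReal (x * d ^ n) := by
    intro n
    induction n with
    | zero => simpa using h0
    | succ n ih =>
      have hdn : ((2 : ℝ) ^ n) ^ b = (d ^ n) ^ (-(κ - 1)) := by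
        rw [hd, ← Real.rpow_natCast (2 ^ (-(b / (κ - 1)))) n, ← Real.rpow_natCast 2 n,
          ← Real.rpow_mul zero_le_two, ← Real.rpow_mul zero_le_two, ← Real.rpow_mul zero_le_two]
        congr 1
        field_simp
      have hdp : 0 < d ^ n := by positivity
      calc F (n + 1) ≤ ENNReal.ofReal (Γ * ((2 : ℝ) ^ n) ^ b) * F n ^ κ := hF n
        _ ≤ ENNReal.ofReal (Γ * ((2 : ℝ) ^ n) ^ b) * ENNReal.ofReal (x * d ^ n) ^ κ := by gcongr
        _ = ENNReal.ofReal (Γ * ((2 : ℝ) ^ n) ^ b * (x * d ^ n) ^ κ) := by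
            rw [ENNReal.ofReal_rpow_of_nonneg (by positivity) (by linarith),
              ← ENNReal.ofReal_mul (by positivity)]
        _ ≤ _ := by
            refine ENNReal.ofReal_le_ofReal ?_
            rw [hdn, Real.mul_rpow hx.le hdp.le]
            have e1 : x ^ κ = x ^ (κ - 1) * x := by
              rw [← Real.rpow_add_one hx.ne', sub_add_cancel]
            have e2 : (d ^ n) ^ κ = (d ^ n) ^ (κ - 1) * d ^ n := by
              rw [← Real.rpow_add_one hdp.ne', sub_add_cancel]
            have e3 : (d ^ n) ^ (-(κ - 1)) * (d ^ n) ^ (κ - 1) = 1 := by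
              rw [← Real.rpow_add hdp, neg_add_cancel, Real.rpow_zero]
            calc Γ * (d ^ n) ^ (-(κ - 1)) * (x ^ κ * (d ^ n) ^ κ)
                = (Γ * x ^ (κ - 1)) * (x * d ^ n) * ((d ^ n) ^ (-(κ - 1)) * (d ^ n) ^ (κ - 1)) := by
                  rw [e1, e2]; ring
              _ ≤ d * (x * d ^ n) * 1 := by rw [e3]; gcongr
              _ = x * d ^ (n + 1) := by ring
  refine tendsto_of_tendsto_of_tendsto_of_le_of_le tendsto_const_nhds ?_ (fun _ => zero_le) hmain
  have := ENNReal.tendsto_ofReal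
    ((tendsto_pow_atTop_nhds_zero_of_lt_one hd0.le hd1).const_mul x)
  simpa using this

/-- Where the left side is nonzero, `δ < y ≤ B`; so `y ^ (a - b)` is bounded by a power of `B` if `b
≤ a` and of `δ` if `a < b`. The maxima treat both cases in one formula. -/
theorem pos_part_rpow_le {a b y B δ : ℝ} (hB : 0 < B) (hδ : 0 < δ) (ha : 0 < a)
    (hy : y ≤ B) :
    max (y - δ) 0 ^ a ≤ B ^ max (a - b) 0 * δ ^ (-max (b - a) 0) * max y 0 ^ b := by
  rcases le_or_gt y δ with h | h
  · rw [max_eq_right (by linarith), Real.zero_rpow ha.ne']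
    positivity
  have hy0 : 0 < y := hδ.trans h
  rw [max_eq_left (by linarith), max_eq_left hy0.le]
  have h1 : (y - δ) ^ a ≤ y ^ a := Real.rpow_le_rpow (by linarith) (by linarith) ha.le
  refine h1.trans ?_
  have h2 : y ^ a = y ^ (a - b) * y ^ b := by rw [← Real.rpow_add hy0, sub_add_cancel]
  rw [h2]
  refine mul_le_mul_of_nonneg_right ?_ (by positivity)
  rcases le_or_gt b a with hab | hab
  · rw [max_eq_left (by linarith), max_eq_right (by linarith), neg_zero, Real.rpow_zero, mul_one]
    exact Real.rpow_le_rpow hy0.le hy (by linarith)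
  · rw [max_eq_right (by linarith), max_eq_left (by linarith), Real.rpow_zero, one_mul, neg_sub]
    exact Real.rpow_le_rpow_of_nonpos hδ h.le (by linarith)

variable {Ω : Type*} [MeasurableSpace Ω] {μ : Measure Ω}

theorem levelInt_add_le {a b k B δ : ℝ} (hB : 0 < B) (hδ : 0 < δ) (ha : 0 < a)
    (hk : 0 ≤ k) {f : Ω → ℝ} (hf : ∀ᵐ x ∂μ, |f x| ≤ B) :
    levelInt μ a (k + δ) f ≤
      ENNReal.ofReal (B ^ max (a - b) 0 * δ ^ (-max (b - a) 0)) * levelInt μ b k f := by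
  rw [levelInt, levelInt, ← lintegral_const_mul' _ _ ENNReal.ofReal_ne_top]
  refine lintegral_mono_ae (hf.mono fun x hx => ?_)
  rw [← ENNReal.ofReal_mul (by positivity)]
  refine ENNReal.ofReal_le_ofReal ?_
  have := pos_part_rpow_le (b := b) hB hδ ha (y := |f x| - k) (by linarith)
  rwa [sub_sub] at this

end DeGiorgi

/-! ### Comparison with truncated data. -/

section Level

variable {Ω : Type*} [MeasurableSpace Ω] {μ : Measure Ω} {q : ℝ≥0} [Fact (1 ≤ (q : ℝ≥0∞))]
  {A : Operator q μ} {ω : ℝ}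

theorem abs_sub_max_min (x : ℝ) {k : ℝ} (hk : 0 ≤ k) :
    |x - max (-k) (min k x)| = max (|x| - k) 0 := by
  rcases le_total x 0 with hx | hx
  · rw [min_eq_right (by linarith), abs_of_nonpos hx]
    rcases le_total (-k) x with h | h
    · rw [max_eq_right h, max_eq_right (by linarith), sub_self, abs_zero]
    · rw [max_eq_left h, max_eq_left (by linarith), abs_of_nonpos (by linarith)]
      ring
  · rw [max_eq_right (show -k ≤ min k x from le_min (by linarith) (by linarith)),
      abs_of_nonneg hx]
    rcases le_total k x with h | h
    · rw [min_eq_left h, max_eq_left (by linarith), abs_of_nonneg (by linarith)]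
    · rw [min_eq_right h, max_eq_right (by linarith), sub_self, abs_zero]

theorem Operator.ae_abs_semigroup_sub_le (hA : (A.addScalar ω).MCompletelyAccretive)
    (hω : 0 ≤ ω) (hd : Dense A.domain) {t : ℝ} (ht : 0 < t) {u w : Lp ℝ (q : ℝ≥0∞) μ} {k : ℝ}
    (hk : 0 ≤ k) (h : ∀ᵐ x ∂μ, |(u - w : Lp ℝ (q : ℝ≥0∞) μ) x| ≤ k) :
    ∀ᵐ x ∂μ, |(A.semigroup t u - A.semigroup t w : Lp ℝ (q : ℝ≥0∞) μ) x| ≤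
      Real.exp (ω * t) * k := by
  have h1 := levelInt_semigroup_le hA hω hd ht u w (p := 1) le_rfl hk
  rw [(levelInt_eq_zero_iff one_pos (Lp.aestronglyMeasurable _)).2 h, mul_zero,
    nonpos_iff_eq_zero, levelInt_eq_zero_iff one_pos (Lp.aestronglyMeasurable _)] at h1
  exact h1

theorem ofReal_norm_rpow (f : Lp ℝ (q : ℝ≥0∞) μ) :
    ENNReal.ofReal (‖f‖ ^ (q : ℝ)) = levelInt μ q 0 f := by
  have hq := one_le_coe_of_fact q
  rw [levelInt_zero_eq hq, ENNReal.ofReal_coe_nnreal, ← ENNReal.ofReal_rpow_of_nonneg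
    (norm_nonneg _) (by linarith), Lp.norm_def, ENNReal.ofReal_toReal (Lp.eLpNorm_ne_top f)]

/-- The regularization estimate for the part above a level, by comparison with the solution
that starts from the truncated datum. -/
theorem Operator.Setting.levelInt_semigroup_sub_le {r : ℝ≥0∞} (hr : 1 ≤ r) (hr' : r ≠ ∞)
    {ρ σ C : ℝ} (hρ : 0 ≤ ρ) (hσ : 0 < σ) (hC : 0 < C) {u₀ : Lp ℝ (q : ℝ≥0∞) μ}
    (hS : A.Setting r ρ σ ω C u₀) {t : ℝ} (ht : 0 < t) (u : Lp ℝ (q : ℝ≥0∞) μ) {k : ℝ}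
    (hk : 0 ≤ k) :
    levelInt μ r.toReal (Real.exp (ω * t) * k)
        (A.semigroup t u - u₀ : Lp ℝ (q : ℝ≥0∞) μ) ≤
      ENNReal.ofReal (((C / q) ^ (1 / σ) * t ^ (-(1 / σ)) *
        Real.exp (ω * (gam q ρ σ + 1) * t)) ^ r.toReal) *
      levelInt μ q k (u - u₀ : Lp ℝ (q : ℝ≥0∞) μ) ^ (gam q ρ σ * r.toReal / q) := by
  have hA := hS.mCompletelyAccretive
  have hω := hS.omega_nonneg
  have hd := hS.dense_domain
  have hq := one_le_coe_of_fact q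
  have hr1 : 1 ≤ r.toReal := by
    rw [← ENNReal.toReal_one]
    exact (ENNReal.toReal_le_toReal ENNReal.one_ne_top hr').2 hr
  set f := u - u₀ with hf
  have hfm : AEStronglyMeasurable f μ := Lp.aestronglyMeasurable _
  -- Removing the truncation of `f` to `[-k, k]` leaves a function of modulus `(|f| - k)₊`, whose
  -- `q`-norm is the level integral of `f` at height `k`.
  have hgm : AEStronglyMeasurable (fun x => f x - max (-k) (min k (f x))) μ :=
    (by fun_prop : Continuous fun y : ℝ => y - max (-k) (min k y)).comp_aestronglyMeasurable hfm
  have hg : MemLp (fun x => f x - max (-k) (min k (f x))) (q : ℝ≥0∞) μ := by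
    refine (Lp.memLp f).of_le hgm (Eventually.of_forall fun x => ?_)
    rw [Real.norm_eq_abs, Real.norm_eq_abs, abs_sub_max_min _ hk]
    exact max_le (by linarith) (abs_nonneg _)
  set g := hg.toLp _ with hgdef
  have hgx : g =ᵐ[μ] fun x => f x - max (-k) (min k (f x)) := hg.coeFn_toLp
  have hclose : ∀ᵐ x ∂μ, |(u - (u₀ + g) : Lp ℝ (q : ℝ≥0∞) μ) x| ≤ k := by
    rw [← sub_sub]
    filter_upwards [Lp.coeFn_sub f g, hgx] with x e1 e2
    rw [e1, Pi.sub_apply, e2, sub_sub_cancel, abs_le]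
    exact ⟨le_max_left _ _, max_le (by linarith) (min_le_left _ _)⟩
  have hT := ae_abs_semigroup_sub_le hA hω hd ht hk hclose
  have hnorm : ENNReal.ofReal (‖u₀ + g - u₀‖ ^ (q : ℝ)) = levelInt μ q k f := by
    rw [add_sub_cancel_left, ofReal_norm_rpow, levelInt_congr hgx]
    refine lintegral_congr fun x => ?_
    rw [sub_zero, abs_sub_max_min _ hk, max_eq_left (le_max_right _ _)]
  have hreg := hS.eLpNorm_semigroup_sub_le hr hρ hσ hC ht (u₀ + g)
  set Λ := (C / q) ^ (1 / σ) * t ^ (-(1 / σ)) * Real.exp (ω * (gam q ρ σ + 1) * t) with hΛ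
  have hΛ0 : 0 ≤ Λ := by positivity
  set w := A.semigroup t (u₀ + g) with hw
  calc levelInt μ r.toReal (Real.exp (ω * t) * k)
        (A.semigroup t u - u₀ : Lp ℝ (q : ℝ≥0∞) μ)
      ≤ levelInt μ r.toReal 0 (w - u₀ : Lp ℝ (q : ℝ≥0∞) μ) := by
        refine lintegral_mono_ae ?_
        filter_upwards [hT, Lp.coeFn_sub (A.semigroup t u) w, Lp.coeFn_sub (A.semigroup t u) u₀,
          Lp.coeFn_sub w u₀] with x e1 e2 e3 e4
        refine ENNReal.ofReal_le_ofReal (Real.rpow_le_rpow (le_max_right _ _) ?_ (by linarith))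
        rw [e2, Pi.sub_apply] at e1
        rw [e3, e4, Pi.sub_apply, Pi.sub_apply, sub_zero]
        refine max_le_max ?_ le_rfl
        have := abs_sub_le (A.semigroup t u x) (w x) (u₀ x)
        linarith
    _ ≤ ENNReal.ofReal (Λ * ‖u₀ + g - u₀‖ ^ gam q ρ σ) ^ r.toReal := by
        rw [levelInt_zero_eq hr1, ENNReal.ofReal_toReal hr']
        gcongr
    _ = ENNReal.ofReal (Λ ^ r.toReal) * levelInt μ q k f ^ (gam q ρ σ * r.toReal / q) := by
        have hγ : 0 ≤ gam q ρ σ := by rw [gam]; positivity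
        rw [← hnorm, ENNReal.ofReal_rpow_of_nonneg (by positivity) (by positivity),
          ENNReal.ofReal_rpow_of_nonneg (by positivity) (by positivity),
          ← ENNReal.ofReal_mul (by positivity), Real.mul_rpow hΛ0 (by positivity),
          ← Real.rpow_mul (norm_nonneg _), ← Real.rpow_mul (norm_nonneg _)]
        congr 3
        field_simp

end Level

/-! ### The orbit at the dyadic times `t (1 - 2⁻ⁿ)`. -/

section Halving

variable {Ω : Type*} [MeasurableSpace Ω] {μ : Measure Ω} {q : ℝ≥0} [Fact (1 ≤ (q : ℝ≥0∞))]
  {A : Operator q μ} {ω : ℝ}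

/-- The values of the semigroup at the times `t (1 - 2⁻ⁿ)`. -/
noncomputable def Operator.dyadicOrbit (A : Operator q μ) (t : ℝ) (u : Lp ℝ (q : ℝ≥0∞) μ) :
    ℕ → Lp ℝ (q : ℝ≥0∞) μ
  | 0 => u
  | n + 1 => A.semigroup (t / 2 ^ (n + 1)) (A.dyadicOrbit t u n)

/-- The remaining time `t / 2ⁿ` is split into two halves, the first of which leads to the next orbit
point. -/
theorem Operator.semigroup_dyadicOrbit (hA : (A.addScalar ω).MCompletelyAccretive)
    (hω : 0 ≤ ω) (hd : Dense A.domain) {t : ℝ} (ht : 0 < t) (u : Lp ℝ (q : ℝ≥0∞) μ) (n : ℕ) :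
    A.semigroup (t / 2 ^ n) (A.dyadicOrbit t u n) = A.semigroup t u := by
  induction n with
  | zero => simp [Operator.dyadicOrbit]
  | succ n ih =>
    rw [← ih, Operator.dyadicOrbit, ← semigroup_two_mul hA hω hd (by positivity)]
    congr 1
    rw [pow_succ]
    field_simp

theorem one_sub_inv_two_pow_succ (n : ℕ) (t : ℝ) :
    t * (1 - 1 / 2 ^ (n + 1)) = t / 2 ^ (n + 1) + t * (1 - 1 / 2 ^ n) := by
  rw [pow_succ]
  field_simp
  ring

theorem Operator.levelInt_dyadicOrbit_le (hA : (A.addScalar ω).MCompletelyAccretive)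
    (hω : 0 ≤ ω) (hd : Dense A.domain) {u₀ : Lp ℝ (q : ℝ≥0∞) μ} (h0 : (u₀, 0) ∈ A) {t : ℝ}
    (ht : 0 < t) (u : Lp ℝ (q : ℝ≥0∞) μ) {p k : ℝ} (hp : 1 ≤ p) (hk : 0 ≤ k) (n : ℕ) :
    levelInt μ p (Real.exp (ω * (t * (1 - 1 / 2 ^ n))) * k)
        (A.dyadicOrbit t u n - u₀ : Lp ℝ (q : ℝ≥0∞) μ) ≤
      ENNReal.ofReal (Real.exp (ω * (t * (1 - 1 / 2 ^ n))) ^ p) *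
        levelInt μ p k (u - u₀ : Lp ℝ (q : ℝ≥0∞) μ) := by
  induction n with
  | zero => simp [Operator.dyadicOrbit]
  | succ n ih =>
    rw [one_sub_inv_two_pow_succ, mul_add, Real.exp_add, mul_assoc, Operator.dyadicOrbit]
    have ht' : 0 < t / 2 ^ (n + 1) := by positivity
    have h1 := levelInt_semigroup_le hA hω hd ht' (A.dyadicOrbit t u n) u₀ hp
      (show 0 ≤ Real.exp (ω * (t * (1 - 1 / 2 ^ n))) * k by positivity)
    rw [semigroup_equilibrium hA hω hd h0 ht'] at h1
    refine h1.trans ?_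
    rw [Real.mul_rpow (by positivity) (by positivity), ENNReal.ofReal_mul (by positivity),
      mul_assoc]
    gcongr

theorem Operator.ae_abs_dyadicOrbit_sub_le (hA : (A.addScalar ω).MCompletelyAccretive)
    (hω : 0 ≤ ω) (hd : Dense A.domain) {u₀ : Lp ℝ (q : ℝ≥0∞) μ} (h0 : (u₀, 0) ∈ A) {t : ℝ}
    (ht : 0 < t) {u : Lp ℝ (q : ℝ≥0∞) μ} {B : ℝ} (hB : 0 ≤ B)
    (hu : ∀ᵐ x ∂μ, |(u - u₀ : Lp ℝ (q : ℝ≥0∞) μ) x| ≤ B) (n : ℕ) :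
    ∀ᵐ x ∂μ, |(A.dyadicOrbit t u n - u₀ : Lp ℝ (q : ℝ≥0∞) μ) x| ≤ Real.exp (ω * t) * B := by
  have h1 := levelInt_dyadicOrbit_le hA hω hd h0 ht u (p := 1) le_rfl hB n
  rw [(levelInt_eq_zero_iff one_pos (Lp.aestronglyMeasurable _)).2 hu, mul_zero,
    nonpos_iff_eq_zero, levelInt_eq_zero_iff one_pos (Lp.aestronglyMeasurable _)] at h1
  filter_upwards [h1] with x hx
  refine hx.trans ?_
  gcongr
  have : (0 : ℝ) ≤ t * (1 / 2 ^ n) := by positivity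
  linarith

end Halving

end NonlinearSemigroup

namespace NonlinearSemigroup

variable {Ω : Type*} [MeasurableSpace Ω] {μ : Measure Ω} {q : ℝ≥0} [Fact (1 ≤ (q : ℝ≥0∞))]
  {A : Operator q μ} {ω : ℝ}

/-! ### The De Giorgi iteration. -/

theorem exists_exp_eq {x : ℝ} (hx : 0 < x) : ∃ y, x = Real.exp y :=
  ⟨Real.log x, (Real.exp_log hx).symm⟩

/-- Used with `w = 2` and with `κ` standing for `γ r / q - 1`. Writing each positive quantity as an
exponential turns an identity of real powers into a polynomial one in the exponents; the other power
identities are proved likewise. -/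
theorem smallness_identity {B k S t c E w : ℝ} (hB : 0 < B) (hk : 0 < k) (hS : 0 < S)
    (ht : 0 < t) (hc : 0 < c) (hE : 0 < E) (hw : 0 < w) (n₁ p₁ n₂ p₂ a s κ : ℝ) :
    B ^ n₁ * k ^ (-p₁) * (w * w) ^ p₁ * (c ^ a * t ^ (-a) * w ^ a * E) *
        (B ^ n₂ * (k / w) ^ (-p₂) * S ^ s) ^ κ =
      ((w * w) ^ p₁ * c ^ a * w ^ a * w ^ (p₂ * κ)) *
        (t ^ (-a) * E * B ^ (n₂ * κ + n₁) * S ^ (s * κ)) * k ^ (-(p₂ * κ + p₁)) := by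
  obtain ⟨B, rfl⟩ := exists_exp_eq hB
  obtain ⟨k, rfl⟩ := exists_exp_eq hk
  obtain ⟨S, rfl⟩ := exists_exp_eq hS
  obtain ⟨t, rfl⟩ := exists_exp_eq ht
  obtain ⟨c, rfl⟩ := exists_exp_eq hc
  obtain ⟨E, rfl⟩ := exists_exp_eq hE
  obtain ⟨w, rfl⟩ := exists_exp_eq hw
  simp only [← Real.exp_add, ← Real.exp_mul, ← Real.exp_sub]
  congr 1
  ring

/-- Used with `X = 2ⁿ` and `w = 2`, to isolate the dependence of the recursion constant on `n`. -/
theorem recursion_identity {B k t c X w : ℝ} (hB : 0 < B) (hk : 0 < k)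
    (ht : 0 < t) (hc : 0 < c) (hX : 0 < X) (hw : 0 < w) (E n₁ p₁ r σ : ℝ) :
    B ^ n₁ * (k / (X * (w * w))) ^ (-p₁) *
        (c ^ (1 / σ) * (t / (X * w)) ^ (-(1 / σ)) * Real.exp E) ^ r =
      B ^ n₁ * k ^ (-p₁) * (w * w) ^ p₁ *
        (c ^ (r / σ) * t ^ (-(r / σ)) * w ^ (r / σ) * Real.exp (E * r)) *
        X ^ (r / σ + p₁) := by
  obtain ⟨B, rfl⟩ := exists_exp_eq hB
  obtain ⟨k, rfl⟩ := exists_exp_eq hk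
  obtain ⟨t, rfl⟩ := exists_exp_eq ht
  obtain ⟨c, rfl⟩ := exists_exp_eq hc
  obtain ⟨X, rfl⟩ := exists_exp_eq hX
  obtain ⟨w, rfl⟩ := exists_exp_eq hw
  simp only [← Real.exp_add, ← Real.exp_mul, ← Real.exp_sub]
  congr 1
  ring

/-- The De Giorgi iteration: a bound for bounded data in terms of a level `k` that is large
compared with the data. -/
theorem Operator.Setting.ae_abs_semigroup_sub_le_of_level {r : ℝ≥0∞} (hr : 1 ≤ r) (hr' : r ≠ ∞)
    {ρ σ C : ℝ} (hρ : 0 ≤ ρ) (hσ : 0 < σ) (hC : 0 < C) {u₀ : Lp ℝ (q : ℝ≥0∞) μ}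
    (hS : A.Setting r ρ σ ω C u₀) (hκ : 1 < gam q ρ σ * r.toReal / q) {s : ℝ}
    {t : ℝ} (ht : 0 < t) {u : Lp ℝ (q : ℝ≥0∞) μ} {B S k : ℝ} (hB : 0 < B) (hS0 : 0 < S)
    (hk : 0 < k) (huB : ∀ᵐ x ∂μ, |(u - u₀ : Lp ℝ (q : ℝ≥0∞) μ) x| ≤ B)
    (huS : levelInt μ s 0 (u - u₀ : Lp ℝ (q : ℝ≥0∞) μ) ≤ ENNReal.ofReal (S ^ s))
    (hlevel : ((2 * 2) ^ max (r.toReal - q) 0 * (C / q) ^ (r.toReal / σ) * 2 ^ (r.toReal / σ) *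
        2 ^ (max (s - q) 0 * (gam q ρ σ * r.toReal / q - 1))) *
        (t ^ (-(r.toReal / σ)) * Real.exp (ω * (gam q ρ σ + 1) * t * r.toReal) *
          (Real.exp (ω * t) * B) ^ (max (q - s) 0 * (gam q ρ σ * r.toReal / q - 1) +
            max (q - r.toReal) 0) *
          S ^ (s * (gam q ρ σ * r.toReal / q - 1))) *
        k ^ (-(max (s - q) 0 * (gam q ρ σ * r.toReal / q - 1) + max (r.toReal - q) 0)) ≤
      2 ^ (-((r.toReal / σ + max (r.toReal - q) 0) / (gam q ρ σ * r.toReal / q - 1)))) :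
    ∀ᵐ x ∂μ, |(A.semigroup t u - u₀ : Lp ℝ (q : ℝ≥0∞) μ) x| ≤ Real.exp (ω * t) * k := by
  have hA := hS.mCompletelyAccretive
  have hω := hS.omega_nonneg
  have hd := hS.dense_domain
  have h0 := hS.equilibrium
  have hq := one_le_coe_of_fact q
  have hq0 : (0 : ℝ) < q := by linarith
  have hR : 1 ≤ r.toReal := by
    rw [← ENNReal.toReal_one]
    exact (ENNReal.toReal_le_toReal ENNReal.one_ne_top hr').2 hr
  have hγ : 0 < gam q ρ σ := by rw [gam]; positivity
  set R := r.toReal with hRdef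
  set γ := gam q ρ σ with hγdef
  set κ := γ * R / q with hκdef
  set v := A.dyadicOrbit t u with hv
  set B' := Real.exp (ω * t) * B with hB'
  have hB'0 : 0 < B' := by positivity
  have hωt : 0 ≤ ω * t := by positivity
  have hBB' : B ≤ B' := by
    have : 1 ≤ Real.exp (ω * t) := Real.one_le_exp hωt
    rw [hB']; nlinarith
  set c : ℕ → ℝ := fun n => Real.exp (ω * (t * (1 - 1 / 2 ^ n))) with hc
  have hc1 : ∀ n, 1 ≤ c n := fun n => by
    refine Real.one_le_exp (mul_nonneg hω (mul_nonneg ht.le ?_))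
    rw [sub_nonneg, div_le_one (by positivity)]
    exact one_le_pow₀ one_le_two
  have hcs : ∀ n, c (n + 1) = Real.exp (ω * (t / 2 ^ (n + 1))) * c n := fun n => by
    simp only [hc]
    rw [one_sub_inv_two_pow_succ, mul_add, Real.exp_add]
  -- The levels rise from `k / 2` towards `k`, multiplied by the growth `c n` that the semigroup has
  -- accumulated.
  set K : ℕ → ℝ := fun n => c n * (k * (1 - 1 / 2 ^ (n + 1))) with hK
  have hl0 : ∀ n : ℕ, (0 : ℝ) ≤ 1 - 1 / 2 ^ n := fun n => by
    rw [sub_nonneg, div_le_one (by positivity)]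
    exact one_le_pow₀ one_le_two
  have hK0 : ∀ n, 0 ≤ K n := fun n =>
    mul_nonneg (by linarith [hc1 n]) (mul_nonneg hk.le (hl0 _))
  set F : ℕ → ℝ≥0∞ := fun n => levelInt μ q (K n) (v n - u₀ : Lp ℝ (q : ℝ≥0∞) μ) with hF
  have hstep : ∀ n, F (n + 1) ≤ ENNReal.ofReal (B' ^ max (q - R) 0 * k ^ (-max (R - q) 0) *
      (2 * 2) ^ max (R - q) 0 * ((C / q) ^ (R / σ) * t ^ (-(R / σ)) * 2 ^ (R / σ) *
      Real.exp (ω * (γ + 1) * t * R)) * ((2 : ℝ) ^ n) ^ (R / σ + max (R - q) 0)) * F n ^ κ := by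
    intro n
    have hτ : 0 < t / 2 ^ (n + 1) := by positivity
    have hvn : v (n + 1) = A.semigroup (t / 2 ^ (n + 1)) (v n) := rfl
    have hlev := hS.levelInt_semigroup_sub_le hr hr' hρ hσ hC hτ (v n) (hK0 n)
    rw [← hvn] at hlev
    have hδ : 0 < k / (2 ^ n * (2 * 2)) := by positivity
    have hadd := levelInt_add_le (μ := μ) (a := q) (b := R) hB'0 hδ hq0
      (k := Real.exp (ω * (t / 2 ^ (n + 1))) * K n) (mul_nonneg (Real.exp_pos _).le (hK0 n))
      (ae_abs_dyadicOrbit_sub_le hA hω hd h0 ht hB.le huB (n + 1))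
    -- The gap between consecutive levels is at least `k / 2 ^ (n + 2)`; it is spent in
    -- `levelInt_add_le` on passing from exponent `r` back to `q`.
    have hKK : Real.exp (ω * (t / 2 ^ (n + 1))) * K n + k / (2 ^ n * (2 * 2)) ≤ K (n + 1) := by
      have e1 : K (n + 1) = Real.exp (ω * (t / 2 ^ (n + 1))) * K n +
          c (n + 1) * (k / (2 ^ n * (2 * 2))) := by
        simp only [hK]
        rw [← mul_assoc (Real.exp (ω * (t / 2 ^ (n + 1)))), ← hcs, pow_succ 2 (n + 1), pow_succ 2 n]
        field_simp
        ring
      rw [e1]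
      nlinarith [hc1 (n + 1)]
    have hexp : (C / q) ^ (1 / σ) * (t / 2 ^ (n + 1)) ^ (-(1 / σ)) *
        Real.exp (ω * (γ + 1) * (t / 2 ^ (n + 1))) ≤
        (C / q) ^ (1 / σ) * (t / (2 ^ n * 2)) ^ (-(1 / σ)) * Real.exp (ω * (γ + 1) * t) := by
      rw [pow_succ]
      gcongr
      exact div_le_self ht.le (by
        rw [← pow_succ]; exact one_le_pow₀ one_le_two)
    calc F (n + 1) ≤ _ := (levelInt_anti hq0.le hKK _).trans hadd
      _ ≤ ENNReal.ofReal (B' ^ max (q - R) 0 * (k / (2 ^ n * (2 * 2))) ^ (-max (R - q) 0)) *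
          (ENNReal.ofReal (((C / q) ^ (1 / σ) * (t / (2 ^ n * 2)) ^ (-(1 / σ)) *
            Real.exp (ω * (γ + 1) * t)) ^ R) * F n ^ κ) := by
          gcongr
          refine hlev.trans ?_
          gcongr
      _ = _ := by
          rw [← mul_assoc, ← ENNReal.ofReal_mul (by positivity),
            recursion_identity hB'0 hk ht (by positivity) (by positivity) two_pos]
  -- The initial gap `k / 2` pays for the passage from exponent `s` to `q`.
  have hstart : F 0 ≤ ENNReal.ofReal (B' ^ max (q - s) 0 * (k / 2) ^ (-max (s - q) 0) * S ^ s) := by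
    have hadd := levelInt_add_le (μ := μ) (a := q) (b := s) hB'0 (half_pos hk) hq0 (k := 0) le_rfl
      (huB.mono fun x hx => hx.trans hBB')
    have e1 : K 0 = 0 + k / 2 := by
      simp only [hK, hc]
      norm_num
      ring
    simp only [hF]
    rw [e1, ENNReal.ofReal_mul (by positivity)]
    refine hadd.trans ?_
    gcongr
  have hlim : Tendsto F atTop (𝓝 0) := by
    refine tendsto_zero_of_fast_recursion (b := R / σ + max (R - q) 0) (κ := κ) (by positivity)
      (by positivity) hκ ?_ hstep hstart ?_
    · have : 0 < R / σ := by positivity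
      positivity
    · rw [smallness_identity hB'0 hk hS0 ht (by positivity) (Real.exp_pos _) two_pos]
      exact hlevel
  -- The time left after `n` steps costs only a bounded factor, so `F n → 0` forces the level
  -- integral at time `t` to vanish.
  have hfinal : ∀ n, levelInt μ q (Real.exp (ω * t) * k)
      (A.semigroup t u - u₀ : Lp ℝ (q : ℝ≥0∞) μ) ≤
        ENNReal.ofReal (Real.exp (ω * t) ^ (q : ℝ)) * F n := by
    intro n
    have hτ : 0 < t / 2 ^ n := by positivity
    have h1 := levelInt_semigroup_le hA hω hd hτ (v n) u₀ hq (hK0 n)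
    rw [semigroup_equilibrium hA hω hd h0 hτ, hv, semigroup_dyadicOrbit hA hω hd ht] at h1
    have hle : Real.exp (ω * (t / 2 ^ n)) ≤ Real.exp (ω * t) := by
      gcongr
      exact div_le_self ht.le (one_le_pow₀ one_le_two)
    have hKle : Real.exp (ω * (t / 2 ^ n)) * K n ≤ Real.exp (ω * t) * k := by
      have e1 : Real.exp (ω * (t / 2 ^ n)) * c n = Real.exp (ω * t) := by
        simp only [hc]
        rw [← Real.exp_add]
        congr 1
        field_simp
        ring
      simp only [hK]
      rw [← mul_assoc, e1]
      refine mul_le_mul_of_nonneg_left ?_ (Real.exp_pos _).le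
      have : 0 ≤ k * (1 / 2 ^ (n + 1)) := by positivity
      linarith
    refine (levelInt_anti hq0.le hKle _).trans (h1.trans ?_)
    gcongr
  have hzero : levelInt μ q (Real.exp (ω * t) * k)
      (A.semigroup t u - u₀ : Lp ℝ (q : ℝ≥0∞) μ) ≤ 0 := by
    have := ENNReal.Tendsto.const_mul hlim
      (Or.inr (ENNReal.ofReal_ne_top (r := Real.exp (ω * t) ^ (q : ℝ))))
    rw [mul_zero] at this
    exact ge_of_tendsto' this hfinal
  exact (levelInt_eq_zero_iff hq0 (Lp.aestronglyMeasurable _)).1 (nonpos_iff_eq_zero.1 hzero)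

end NonlinearSemigroup

namespace NonlinearSemigroup

variable {Ω : Type*} [MeasurableSpace Ω] {μ : Measure Ω} {q : ℝ≥0} [Fact (1 ≤ (q : ℝ≥0∞))]
  {A : Operator q μ} {ω : ℝ}

/-! ### Removing the initial supremum and lowering the exponential rate. -/

theorem Operator.levelInt_zero_semigroup_sub_le (hA : (A.addScalar ω).MCompletelyAccretive)
    (hω : 0 ≤ ω) (hd : Dense A.domain) {u₀ : Lp ℝ (q : ℝ≥0∞) μ} (h0 : (u₀, 0) ∈ A) {t : ℝ}
    (ht : 0 < t) {u : Lp ℝ (q : ℝ≥0∞) μ} {s S : ℝ} (hs : 1 ≤ s) (hS : 0 < S)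
    (hu : levelInt μ s 0 (u - u₀ : Lp ℝ (q : ℝ≥0∞) μ) ≤ ENNReal.ofReal (S ^ s)) :
    levelInt μ s 0 (A.semigroup t u - u₀ : Lp ℝ (q : ℝ≥0∞) μ) ≤
      ENNReal.ofReal ((Real.exp (ω * t) * S) ^ s) := by
  have h1 := levelInt_semigroup_le hA hω hd ht u u₀ hs le_rfl
  rw [semigroup_equilibrium hA hω hd h0 ht, mul_zero] at h1
  refine h1.trans ?_
  rw [Real.mul_rpow (by positivity) hS.le, ENNReal.ofReal_mul (by positivity)]
  gcongr

/-- `H` is chosen so that the profile `H t ^ (-x / (1 - η))` reproduces itself under one application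
of the estimate over half the time; only the exponent of the excess factor `Y` shrinks, by `η`. -/
theorem absorption_identity {c t S H Y : ℝ} (hc : 0 < c) (ht : 0 < t) (hS : 0 < S)
    (hH : 0 < H) (hY : 0 < Y) (e x η z m : ℝ) (hη : η < 1)
    (hHdef : H ^ (1 - η) = c * 2 ^ (x + x / (1 - η) * η) * Real.exp e * S ^ z) :
    c * (t / 2) ^ (-x) * Real.exp e * (H * (t / 2) ^ (-(x / (1 - η))) * Y ^ m) ^ η * S ^ z =
      H * t ^ (-(x / (1 - η))) * Y ^ (m * η) := by
  have hη' : 1 - η ≠ 0 := by linarith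
  have h1 : H = H ^ (1 - η) * H ^ η := by
    rw [← Real.rpow_add hH, sub_add_cancel, Real.rpow_one]
  have h2 : c * (t / 2) ^ (-x) * Real.exp e * (H * (t / 2) ^ (-(x / (1 - η))) * Y ^ m) ^ η *
      S ^ z = c * 2 ^ (x + x / (1 - η) * η) * Real.exp e * S ^ z * H ^ η *
        (t ^ (-(x / (1 - η))) * Y ^ (m * η)) := by
    clear h1 hHdef
    obtain ⟨c, rfl⟩ := exists_exp_eq hc
    obtain ⟨t, rfl⟩ := exists_exp_eq ht
    obtain ⟨S, rfl⟩ := exists_exp_eq hS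
    obtain ⟨H, rfl⟩ := exists_exp_eq hH
    obtain ⟨Y, rfl⟩ := exists_exp_eq hY
    obtain ⟨w, hw⟩ := exists_exp_eq (two_pos (α := ℝ))
    rw [hw]
    simp only [← Real.exp_add, ← Real.exp_mul, ← Real.exp_sub]
    congr 1
    field_simp
    ring
  rw [h2, ← hHdef, ← h1, mul_assoc]

/-- A smoothing estimate with a small power `η < 1` of the supremum of the initial value on the
right-hand side implies one without it. -/
theorem Operator.Setting.absorb {r : ℝ≥0∞} {ρ σ C : ℝ} {u₀ : Lp ℝ (q : ℝ≥0∞) μ}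
    (hSet : A.Setting r ρ σ ω C u₀) {s : ℝ} (hs : 1 ≤ s) {c x y η z : ℝ} (hc : 0 < c)
    (hx : 0 < x) (hy : 0 ≤ y) (hη0 : 0 ≤ η) (hη : η < 1)
    (hstep : ∀ (t : ℝ) (u : Lp ℝ (q : ℝ≥0∞) μ) (B S : ℝ), 0 < t → 0 < B → 0 < S →
      (∀ᵐ a ∂μ, |(u - u₀ : Lp ℝ (q : ℝ≥0∞) μ) a| ≤ B) →
      levelInt μ s 0 (u - u₀ : Lp ℝ (q : ℝ≥0∞) μ) ≤ ENNReal.ofReal (S ^ s) →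
      ∀ᵐ a ∂μ, |(A.semigroup t u - u₀ : Lp ℝ (q : ℝ≥0∞) μ) a| ≤
        c * t ^ (-x) * Real.exp (ω * y * t) * B ^ η * S ^ z)
    {t : ℝ} (ht : 0 < t) {u : Lp ℝ (q : ℝ≥0∞) μ} {B S : ℝ} (hB : 0 < B) (hS : 0 < S)
    (huB : ∀ᵐ a ∂μ, |(u - u₀ : Lp ℝ (q : ℝ≥0∞) μ) a| ≤ B)
    (huS : levelInt μ s 0 (u - u₀ : Lp ℝ (q : ℝ≥0∞) μ) ≤ ENNReal.ofReal (S ^ s)) :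
    ∀ᵐ a ∂μ, |(A.semigroup t u - u₀ : Lp ℝ (q : ℝ≥0∞) μ) a| ≤
      (c * 2 ^ (x + x / (1 - η) * η)) ^ (1 / (1 - η)) * t ^ (-(x / (1 - η))) *
        Real.exp (ω * ((y + z) / (1 - η)) * t) * S ^ (z / (1 - η)) := by
  have hA := hSet.mCompletelyAccretive
  have hω := hSet.omega_nonneg
  have hd := hSet.dense_domain
  have h0 := hSet.equilibrium
  have hη' : 0 < 1 - η := by linarith
  set S' := Real.exp (ω * t) * S with hS'
  have hS'0 : 0 < S' := by positivity
  set H := (c * 2 ^ (x + x / (1 - η) * η) * Real.exp (ω * y * t) * S' ^ z) ^ (1 / (1 - η)) with hH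
  have hH0 : 0 < H := by positivity
  have hHpow : H ^ (1 - η) =
      c * 2 ^ (x + x / (1 - η) * η) * Real.exp (ω * y * t) * S' ^ z := by
    rw [hH, ← Real.rpow_mul (by positivity), one_div, inv_mul_cancel₀ hη'.ne', Real.rpow_one]
  -- `Y` absorbs the possibly huge initial bound; after `n` halvings it appears to the power `η ^
  -- n`, which tends to `0`.
  set Y := max 1 (Real.exp (ω * t) * B / (H * t ^ (-(x / (1 - η))))) with hY
  have hY1 : 1 ≤ Y := le_max_left _ _
  have hYB : Real.exp (ω * t) * B ≤ H * t ^ (-(x / (1 - η))) * Y := by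
    rw [mul_comm _ Y, ← div_le_iff₀ (by positivity)]
    exact le_max_right _ _
  have hx' : 0 < x / (1 - η) := by positivity
  have hmain : ∀ n : ℕ, ∀ τ : ℝ, 0 < τ → τ ≤ t →
      ∀ᵐ a ∂μ, |(A.semigroup τ u - u₀ : Lp ℝ (q : ℝ≥0∞) μ) a| ≤
        H * τ ^ (-(x / (1 - η))) * Y ^ (η ^ n) := by
    intro n
    induction n with
    | zero =>
      intro τ hτ hτt
      have h1 := ae_abs_semigroup_sub_le hA hω hd hτ hB.le huB
      rw [semigroup_equilibrium hA hω hd h0 hτ] at h1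
      filter_upwards [h1] with a ha
      rw [pow_zero, Real.rpow_one]
      calc _ ≤ Real.exp (ω * τ) * B := ha
        _ ≤ Real.exp (ω * t) * B := by gcongr
        _ ≤ H * t ^ (-(x / (1 - η))) * Y := hYB
        _ ≤ _ := by
          have := Real.rpow_le_rpow_of_nonpos hτ hτt (neg_nonpos.2 hx'.le)
          gcongr
    | succ n ih =>
      intro τ hτ hτt
      have hτ2 : 0 < τ / 2 := by positivity
      have h1 := hstep (τ / 2) (A.semigroup (τ / 2) u) _ S' hτ2 (by positivity) hS'0
        (ih (τ / 2) hτ2 (by linarith)) (by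
          refine (levelInt_zero_semigroup_sub_le hA hω hd h0 hτ2 hs hS huS).trans ?_
          have : τ / 2 ≤ t := by linarith
          rw [hS']
          gcongr)
      rw [← semigroup_two_mul hA hω hd hτ2, mul_div_cancel₀ τ two_ne_zero] at h1
      filter_upwards [h1] with a ha
      rw [pow_succ, ← absorption_identity hc hτ hS'0 hH0 (by positivity) (ω * y * t) x η z
        (η ^ n) hη hHpow]
      refine ha.trans ?_
      have : τ / 2 ≤ t := by linarith
      gcongr
  have hall := ae_all_iff.2 fun n => hmain n t ht le_rfl
  filter_upwards [hall] with a ha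
  have hlim : Tendsto (fun n : ℕ => H * t ^ (-(x / (1 - η))) * Y ^ (η ^ n)) atTop
      (𝓝 (H * t ^ (-(x / (1 - η))) * 1)) := by
    refine Tendsto.const_mul _ ?_
    rw [← Real.rpow_zero Y]
    exact tendsto_const_nhds.rpow (tendsto_pow_atTop_nhds_zero_of_lt_one hη0 hη)
      (Or.inl (by positivity))
  refine (ge_of_tendsto' hlim ha).trans_eq ?_
  rw [mul_one, hH, hS', Real.mul_rpow (by positivity) hS.le, ← Real.exp_mul, ← mul_assoc,
    mul_assoc _ (Real.exp _) (Real.exp _), ← Real.exp_add, Real.mul_rpow (by positivity)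
    (by positivity), Real.mul_rpow (by positivity) (by positivity), ← Real.exp_mul,
    ← Real.rpow_mul hS.le]
  have e1 : (ω * y * t + ω * t * z) * (1 / (1 - η)) = ω * ((y + z) / (1 - η)) * t := by
    field_simp
  rw [e1, mul_one_div]
  ring

/-- The factor `exp (ω b t)` of a smoothing estimate can be replaced by `exp (ω b' t)` for each
`b' > g`, at the expense of the constant. -/
theorem Operator.Setting.improve_exponential {r : ℝ≥0∞} {ρ σ C : ℝ}
    {u₀ : Lp ℝ (q : ℝ≥0∞) μ} (hSet : A.Setting r ρ σ ω C u₀) {s : ℝ} (hs : 1 ≤ s)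
    {H x b b' g : ℝ} (hH : 0 < H) (n : ℕ) (hn : b / 2 ^ n + g ≤ b')
    (hstep : ∀ (t : ℝ) (u : Lp ℝ (q : ℝ≥0∞) μ) (B S : ℝ), 0 < t → 0 < B → 0 < S →
      (∀ᵐ a ∂μ, |(u - u₀ : Lp ℝ (q : ℝ≥0∞) μ) a| ≤ B) →
      levelInt μ s 0 (u - u₀ : Lp ℝ (q : ℝ≥0∞) μ) ≤ ENNReal.ofReal (S ^ s) →
      ∀ᵐ a ∂μ, |(A.semigroup t u - u₀ : Lp ℝ (q : ℝ≥0∞) μ) a| ≤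
        H * t ^ (-x) * Real.exp (ω * b * t) * S ^ g)
    {t : ℝ} (ht : 0 < t) {u : Lp ℝ (q : ℝ≥0∞) μ} {B S : ℝ} (hB : 0 < B) (hS : 0 < S)
    (huB : ∀ᵐ a ∂μ, |(u - u₀ : Lp ℝ (q : ℝ≥0∞) μ) a| ≤ B)
    (huS : levelInt μ s 0 (u - u₀ : Lp ℝ (q : ℝ≥0∞) μ) ≤ ENNReal.ofReal (S ^ s)) :
    ∀ᵐ a ∂μ, |(A.semigroup t u - u₀ : Lp ℝ (q : ℝ≥0∞) μ) a| ≤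
      H * (2 ^ n) ^ x * t ^ (-x) * Real.exp (ω * b' * t) * S ^ g := by
  have hA := hSet.mCompletelyAccretive
  have hω := hSet.omega_nonneg
  have hd := hSet.dense_domain
  have h0 := hSet.equilibrium
  -- The crude growth bound is used up to time `t (1 - 2⁻ⁿ)` and the smoothing only on the last
  -- piece `t / 2ⁿ`. The rate becomes at most `b / 2ⁿ + g`, where `g` comes from the growth of `S`.
  have hS' : levelInt μ s 0 (A.dyadicOrbit t u n - u₀ : Lp ℝ (q : ℝ≥0∞) μ) ≤
      ENNReal.ofReal ((Real.exp (ω * t) * S) ^ s) := by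
    have h1 := levelInt_dyadicOrbit_le hA hω hd h0 ht u hs (k := 0) le_rfl n
    rw [mul_zero] at h1
    refine h1.trans ?_
    rw [Real.mul_rpow (by positivity) hS.le, ENNReal.ofReal_mul (by positivity)]
    have : t * (1 - 1 / 2 ^ n) ≤ t := by
      have : (0 : ℝ) ≤ t * (1 / 2 ^ n) := by positivity
      linarith
    gcongr
  have h1 := hstep (t / 2 ^ n) (A.dyadicOrbit t u n) _ _ (by positivity) (by positivity)
    (by positivity) (ae_abs_dyadicOrbit_sub_le hA hω hd h0 ht hB.le huB n) hS'
  rw [semigroup_dyadicOrbit hA hω hd ht] at h1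
  filter_upwards [h1] with a ha
  refine ha.trans ?_
  have e1 : (t / 2 ^ n) ^ (-x) = (2 ^ n) ^ x * t ^ (-x) := by
    rw [Real.div_rpow ht.le (by positivity), Real.rpow_neg (by positivity : (0 : ℝ) ≤ 2 ^ n),
      div_inv_eq_mul, mul_comm]
  rw [e1, Real.mul_rpow (by positivity) hS.le, ← Real.exp_mul]
  calc _ = H * (2 ^ n) ^ x * t ^ (-x) *
        (Real.exp (ω * b * (t / 2 ^ n)) * Real.exp (ω * t * g)) * S ^ g := by ring
    _ ≤ _ := by
        rw [← Real.exp_add]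
        gcongr
        calc ω * b * (t / 2 ^ n) + ω * t * g = ω * t * (b / 2 ^ n + g) := by ring
          _ ≤ ω * t * b' := by gcongr
          _ = ω * b' * t := by ring

theorem level_identity {c d t S B : ℝ} (hc : 0 < c) (hd : 0 < d) (ht : 0 < t) (hS : 0 < S)
    (hB : 0 < B) (a e f N z : ℝ) {P : ℝ} (hP : 0 < P) :
    Real.exp e * (c / d * (t ^ (-a) * Real.exp f * (Real.exp e * B) ^ N * S ^ z)) ^ (1 / P) =
      (c / d) ^ (1 / P) * t ^ (-(a / P)) * Real.exp (e + (f + e * N) / P) * B ^ (N / P) *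
        S ^ (z / P) := by
  obtain ⟨c, rfl⟩ := exists_exp_eq hc
  obtain ⟨d, rfl⟩ := exists_exp_eq hd
  obtain ⟨t, rfl⟩ := exists_exp_eq ht
  obtain ⟨S, rfl⟩ := exists_exp_eq hS
  obtain ⟨B, rfl⟩ := exists_exp_eq hB
  simp only [← Real.exp_add, ← Real.exp_mul, ← Real.exp_sub]
  congr 1
  field_simp
  ring

/-- The best level satisfies `k ^ P = const * B ^ N * S ^ (s (κ - 1))` up to time factors, and `P -
N = D > 0` makes the power `N / P` of `B` less than `1`, hence absorbable. All choices precede `Ω`,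
`A` and `ω`, so `K` is uniform. -/
theorem Operator.Setting.exists_smoothing_of_bounded {r : ℝ≥0∞} (hr : 1 ≤ r) (hr' : r ≠ ∞)
    {ρ σ C : ℝ} (hρ : 0 ≤ ρ) (hσ : 0 < σ) (hC : 0 < C) (q : ℝ≥0) [Fact (1 ≤ (q : ℝ≥0∞))]
    (hκ : 1 < gam q ρ σ * r.toReal / q) {s : ℝ} (hs : 1 ≤ s) {D b' : ℝ}
    (hD : D = (s - q) * (gam q ρ σ * r.toReal / q - 1) + (r.toReal - q)) (hD0 : 0 < D)
    (hb' : s * (gam q ρ σ * r.toReal / q - 1) / D < b') :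
    ∃ K : ℝ, 0 < K ∧ ∀ (Ω : Type*) [MeasurableSpace Ω] (μ : Measure Ω)
      (A : Operator q μ) (ω : ℝ) (u₀ : Lp ℝ (q : ℝ≥0∞) μ), A.Setting r ρ σ ω C u₀ →
      ∀ (t : ℝ) (u : Lp ℝ (q : ℝ≥0∞) μ) (B S : ℝ), 0 < t → 0 < B → 0 < S →
      (∀ᵐ a ∂μ, |(u - u₀ : Lp ℝ (q : ℝ≥0∞) μ) a| ≤ B) →
      levelInt μ s 0 (u - u₀ : Lp ℝ (q : ℝ≥0∞) μ) ≤ ENNReal.ofReal (S ^ s) →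
      ∀ᵐ a ∂μ, |(A.semigroup t u - u₀ : Lp ℝ (q : ℝ≥0∞) μ) a| ≤
        K * t ^ (-(r.toReal / σ / D)) * Real.exp (ω * b' * t) *
          S ^ (s * (gam q ρ σ * r.toReal / q - 1) / D) := by
  have hq := one_le_coe_of_fact q
  have hR : 1 ≤ r.toReal := by
    rw [← ENNReal.toReal_one]
    exact (ENNReal.toReal_le_toReal ENNReal.one_ne_top hr').2 hr
  have hγ : 0 < gam q ρ σ := by rw [gam]; positivity
  set κ := gam q ρ σ * r.toReal / q - 1 with hκdef
  have hκ1 : 0 < κ := by linarith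
  set P := max (s - q) 0 * κ + max (r.toReal - q) 0 with hP
  set N := max (q - s) 0 * κ + max (q - r.toReal) 0 with hN
  have hN0 : 0 ≤ N := by positivity
  have hPND : P - N = D := by
    have e : ∀ a b : ℝ, max (a - b) 0 - max (b - a) 0 = a - b := fun a b => by
      rcases le_total a b with h | h
      · rw [max_eq_right (by linarith), max_eq_left (by linarith)]; ring
      · rw [max_eq_left (by linarith), max_eq_right (by linarith)]; ring
    rw [hP, hN, hD]
    linear_combination κ * e s q + e r.toReal q
  have hP0 : 0 < P := by linarith
  have h1η : 1 - N / P = D / P := by rw [← hPND]; field_simp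
  have hη : N / P < 1 := by
    rw [div_lt_one hP0]; linarith
  set c : ℝ := (2 * 2) ^ max (r.toReal - q) 0 * (C / q) ^ (r.toReal / σ) * 2 ^ (r.toReal / σ) *
        2 ^ (max (s - q) 0 * κ) with hc
  have hc0 : 0 < c := by positivity
  set d : ℝ := 2 ^ (-((r.toReal / σ + max (r.toReal - q) 0) / κ)) with hd
  have hd0 : 0 < d := by positivity
  set x := r.toReal / σ / P with hx
  set y := 1 + ((gam q ρ σ + 1) * r.toReal + N) / P with hy
  have hx0 : 0 < x := by positivity
  have hy0 : 0 ≤ y := by positivity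
  set c₁ := (c / d) ^ (1 / P) with hc₁
  have hc₁0 : 0 < c₁ := by positivity
  set z := s * κ / P with hz
  have hz0 : 0 ≤ z := by positivity
  set H := (c₁ * 2 ^ (x + x / (1 - N / P) * (N / P))) ^ (1 / (1 - N / P)) with hH
  have hH0 : 0 < H := by positivity
  set b := (y + z) / (1 - N / P) with hb
  have hxD : x / (1 - N / P) = r.toReal / σ / D := by
    rw [h1η, hx]; field_simp
  have hzD : z / (1 - N / P) = s * κ / D := by
    rw [h1η, hz]; field_simp
  -- The number of halvings depends on exponents only, never on `ω`; the strict inequality `hb'` is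
  -- what makes it finite.
  obtain ⟨n, hn⟩ : ∃ n : ℕ, b / 2 ^ n + s * κ / D ≤ b' := by
    have h1 : Tendsto (fun n : ℕ => b * (1 / 2) ^ n + s * κ / D) atTop
        (𝓝 (b * 0 + s * κ / D)) :=
      ((tendsto_pow_atTop_nhds_zero_of_lt_one (by norm_num) (by norm_num)).const_mul b).add_const _
    rw [mul_zero, zero_add] at h1
    obtain ⟨n, hn⟩ := (h1.eventually_le_const hb').exists
    refine ⟨n, ?_⟩
    rwa [one_div, inv_pow, ← div_eq_mul_inv] at hn
  refine ⟨H * (2 ^ n) ^ (r.toReal / σ / D), by positivity, ?_⟩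
  intro Ω _ μ A ω u₀ hSet t u B S ht hB hS huB huS
  refine hSet.improve_exponential hs hH0 n hn ?_ ht hB hS huB huS
  clear huS huB hS hB ht S B u t
  intro t u B S ht hB hS huB huS
  rw [← hxD, ← hzD]
  refine hSet.absorb hs hc₁0 hx0 hy0 (by positivity) hη ?_ ht hB hS huB huS
  clear huS huB hS hB ht S B u t
  intro t u B S ht hB hS huB huS
  have hω := hSet.omega_nonneg
  set Z := t ^ (-(r.toReal / σ)) * Real.exp (ω * (gam q ρ σ + 1) * t * r.toReal) *
    (Real.exp (ω * t) * B) ^ N * S ^ (s * κ) with hZ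
  have hZ0 : 0 < Z := by positivity
  -- This level gives equality in the smallness condition of the iteration.
  have hk0 : 0 < (c / d * Z) ^ (1 / P) := by positivity
  have := hSet.ae_abs_semigroup_sub_le_of_level hr hr' hρ hσ hC hκ ht hB hS hk0 huB huS (by
    change c * Z * ((c / d * Z) ^ (1 / P)) ^ (-P) ≤ d
    rw [← Real.rpow_mul (by positivity), mul_neg, one_div, inv_mul_cancel₀ hP0.ne',
      Real.rpow_neg_one]
    refine le_of_eq ?_
    field_simp)
  filter_upwards [this] with a ha
  refine ha.trans_eq ?_
  rw [hZ, level_identity hc0 hd0 ht hS hB _ _ _ _ _ hP0]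
  have e1 : ω * t + (ω * (gam q ρ σ + 1) * t * r.toReal + ω * t * N) / P = ω * y * t := by
    rw [hy]; field_simp
  rw [e1]

end NonlinearSemigroup

namespace NonlinearSemigroup

/-! ### Identification of the exponents. -/

section ExponentIdentities

variable {q r σ γ m₀ s : ℝ}

/-- The numerator is free of `m₀`, and the denominator cancels against those of `α*` and `γ* θ`. The
condition `γ* (1 - θ) < 1` thus means `D > 0`. -/
theorem one_sub_gammaStar_mul (hq : 0 < q) (hr : 0 < r) (hγ : 0 < γ) (hm : 0 < m₀)
    (hden : 0 < den q r γ m₀) :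
    1 - gammaStar q r γ m₀ * (1 - theta q r γ m₀ s) =
      ((s - q) * (γ * r / q - 1) + (r - q)) / (γ * r / q * den q r γ m₀) := by
  have h : gammaStar q r γ m₀ * den q r γ m₀ = (γ * r / q - 1) * m₀ := by
    rw [gammaStar, div_mul_cancel₀ _ hden.ne']
  rw [eq_div_iff (by positivity)]
  have : (1 - gammaStar q r γ m₀ * (1 - theta q r γ m₀ s)) * (γ * r / q * den q r γ m₀) =
      γ * r / q * (den q r γ m₀ -
        gammaStar q r γ m₀ * den q r γ m₀ * (1 - theta q r γ m₀ s)) := by ring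
  rw [this, h, den, theta]
  field_simp
  ring

theorem alphaS_eq (hq : 0 < q) (hr : 0 < r) (hγ : 0 < γ) (hm : 0 < m₀)
    (hden : 0 < den q r γ m₀) (hD : 0 < (s - q) * (γ * r / q - 1) + (r - q)) :
    alphaS q r σ γ m₀ s = r / σ / ((s - q) * (γ * r / q - 1) + (r - q)) := by
  rw [alphaS, one_sub_gammaStar_mul hq hr hγ hm hden, alphaStar]
  generalize (s - q) * (γ * r / q - 1) + (r - q) = D at *
  generalize den q r γ m₀ = e at *
  field_simp

theorem gammaS_eq (hq : 0 < q) (hr : 0 < r) (hγ : 0 < γ) (hm : 0 < m₀)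
    (hden : 0 < den q r γ m₀) (hD : 0 < (s - q) * (γ * r / q - 1) + (r - q)) :
    gammaS q r γ m₀ s = s * (γ * r / q - 1) / ((s - q) * (γ * r / q - 1) + (r - q)) := by
  rw [gammaS, one_sub_gammaStar_mul hq hr hγ hm hden, gammaStar, theta]
  generalize (s - q) * (γ * r / q - 1) + (r - q) = D at *
  generalize den q r γ m₀ = e at *
  field_simp

theorem betaStar_pos (hq : 1 ≤ q) (hγ : 0 < γ) (hκ : 1 < γ * r / q) (hm : q / γ ≤ m₀)
    (hden : 0 < den q r γ m₀) : 0 < betaStar q r γ m₀ := by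
  have h1 : betaStar q r γ m₀ = (γ * (γ * r / q) - 1 + den q r γ m₀) / den q r γ m₀ := by
    rw [betaStar]
    field_simp
  rw [h1]
  refine div_pos ?_ hden
  rcases le_or_gt 1 γ with h | h
  · nlinarith
  -- For `γ < 1` the bounds `m₀ ≥ q / γ` and `κ > 1` show that the numerator exceeds `(1 - γ) (q / γ
  -- - 1) > 0`.
  · rw [den]
    generalize γ * r / q = κ at *
    have h2 : (κ - 1) * (q / γ) ≤ (κ - 1) * m₀ := mul_le_mul_of_nonneg_left hm (by linarith)
    have h3 : 1 < q / γ := by rw [lt_div_iff₀ hγ]; linarith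
    have h4 : γ * (q / γ) = q := by field_simp
    have h5 : q * (1 / γ - 1) = q / γ - q := by ring
    nlinarith [mul_pos (sub_pos.2 h) (sub_pos.2 h3), mul_pos hγ (sub_pos.2 hκ),
      mul_pos (sub_pos.2 hκ) (show 0 < q / γ by linarith)]

/-- This strict gap is the room that `improve_exponential` needs. -/
theorem gammaS_lt_betaS (hq : 1 ≤ q) (hγ : 0 < γ) (hκ : 1 < γ * r / q)
    (hm : q / γ ≤ m₀) (hden : 0 < den q r γ m₀)
    (h : gammaStar q r γ m₀ * (1 - theta q r γ m₀ s) < 1) :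
    gammaS q r γ m₀ s < betaS q r γ m₀ s := by
  rw [gammaS, betaS]
  have := betaStar_pos hq hγ hκ hm hden
  refine div_lt_div_of_pos_right ?_ (by linarith)
  linarith

end ExponentIdentities

/-! ### Extension of the semigroup and of the estimate to `L^s`. -/

section Extension

variable {Ω : Type*} [MeasurableSpace Ω] {μ : Measure Ω} {q : ℝ≥0} [Fact (1 ≤ (q : ℝ≥0∞))]
  {A : Operator q μ} {ω : ℝ}

theorem memLp_of_memLp_one_top {f : Ω → ℝ} (h1 : MemLp f 1 μ) (h2 : MemLp f ∞ μ) (s : ℝ≥0)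
    [Fact (1 ≤ (s : ℝ≥0∞))] : MemLp f s μ := by
  have hs := one_le_coe_of_fact s
  set B := (eLpNorm f ∞ μ).toReal with hB
  have hfB : ∀ᵐ x ∂μ, |f x| ≤ B := ae_abs_le_of_eLpNorm_top_le ENNReal.toReal_nonneg
    (ENNReal.ofReal_toReal h2.eLpNorm_ne_top).ge
  have hle : levelInt μ s 0 f ≤ ENNReal.ofReal (B ^ ((s : ℝ) - 1)) * levelInt μ 1 0 f := by
    rw [levelInt, levelInt, ← lintegral_const_mul' _ _ ENNReal.ofReal_ne_top]
    refine lintegral_mono_ae (hfB.mono fun x hx => ?_)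
    rw [← ENNReal.ofReal_mul (by positivity), sub_zero, max_eq_left (abs_nonneg _), Real.rpow_one]
    refine ENNReal.ofReal_le_ofReal ?_
    calc |f x| ^ (s : ℝ) = |f x| ^ ((s : ℝ) - 1 + 1) := by rw [sub_add_cancel]
      _ = |f x| ^ ((s : ℝ) - 1) * |f x| := by
        rw [Real.rpow_add_of_nonneg (abs_nonneg _) (by linarith) zero_le_one, Real.rpow_one]
      _ ≤ _ := by
        have : 0 ≤ (s : ℝ) - 1 := by linarith
        gcongr
  rw [levelInt_zero_eq hs, levelInt_zero_eq le_rfl, ENNReal.ofReal_one, ENNReal.rpow_one,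
    ENNReal.ofReal_coe_nnreal] at hle
  refine ⟨h1.1, ?_⟩
  have h3 := hle.trans_lt (ENNReal.mul_lt_top ENNReal.ofReal_lt_top h1.2)
  exact (ENNReal.rpow_lt_top_iff_of_pos (by linarith)).1 h3

/-- Simple functions suffice: for any finite nonzero exponent, membership in the Lebesgue space
means support of finite measure. -/
theorem dense_memLp_and_memLp_top (q s : ℝ≥0) [Fact (1 ≤ (q : ℝ≥0∞))]
    [Fact (1 ≤ (s : ℝ≥0∞))] :
    Dense {w : Lp ℝ (s : ℝ≥0∞) μ | MemLp w q μ ∧ MemLp w ∞ μ} := by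
  have hne : ∀ p : ℝ≥0, Fact (1 ≤ (p : ℝ≥0∞)) → (p : ℝ≥0∞) ≠ 0 := fun p hp =>
    (zero_lt_one.trans_le hp.out).ne'
  refine (Lp.simpleFunc.dense (E := ℝ) (μ := μ) (ENNReal.coe_ne_top (r := s))).mono ?_
  intro w hw
  have hae := Lp.simpleFunc.toSimpleFunc_eq_toFun (⟨w, hw⟩ : Lp.simpleFunc ℝ (s : ℝ≥0∞) μ)
  have hmem := Lp.simpleFunc.memLp (⟨w, hw⟩ : Lp.simpleFunc ℝ (s : ℝ≥0∞) μ)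
  rw [SimpleFunc.memLp_iff_finMeasSupp (hne s inferInstance) ENNReal.coe_ne_top,
    ← SimpleFunc.memLp_iff_finMeasSupp (hne q inferInstance) (ENNReal.coe_ne_top (r := q))] at hmem
  exact ⟨hmem.ae_eq hae, (SimpleFunc.memLp_top _ μ).ae_eq hae⟩

theorem Operator.Setting.memLp_semigroup {r : ℝ≥0∞} {ρ σ C : ℝ} {u₀ : Lp ℝ (q : ℝ≥0∞) μ}
    (hS : A.Setting r ρ σ ω C u₀) {t : ℝ} (ht : 0 < t) (s : ℝ≥0) [Fact (1 ≤ (s : ℝ≥0∞))]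
    {u : Lp ℝ (q : ℝ≥0∞) μ} (hu : MemLp u s μ) : MemLp (A.semigroup t u) s μ := by
  have h0 : MemLp u₀ s μ := memLp_of_memLp_one_top hS.memLp_one hS.memLp_top s
  have h1 := eLpNorm_semigroup_le hS.mCompletelyAccretive hS.omega_nonneg hS.dense_domain ht u u₀
    (p := s) Fact.out
  rw [semigroup_equilibrium hS.mCompletelyAccretive hS.omega_nonneg hS.dense_domain
    hS.equilibrium ht] at h1
  have h2 : MemLp (u - u₀ : Lp ℝ (q : ℝ≥0∞) μ) s μ :=
    (hu.sub h0).ae_eq (Lp.coeFn_sub u u₀).symm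
  have h3 : MemLp (A.semigroup t u - u₀ : Lp ℝ (q : ℝ≥0∞) μ) s μ :=
    ⟨Lp.aestronglyMeasurable _, h1.trans_lt (ENNReal.mul_lt_top ENNReal.ofReal_lt_top h2.2)⟩
  refine (h3.add h0).ae_eq ?_
  filter_upwards [Lp.coeFn_sub (A.semigroup t u) u₀] with x hx
  rw [Pi.add_apply, hx, Pi.sub_apply, sub_add_cancel]

/-- In the `s`-norm `T_t` is Lipschitz with constant `e^{ωt}` on `L^q ∩ L^s`, which is dense in
`L^s`; it maps into `L^s` because it fixes `u₀`, an element of every `L^s`. -/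
theorem Operator.Setting.existsUnique_continuousExtension {r : ℝ≥0∞} {ρ σ C : ℝ}
    {u₀ : Lp ℝ (q : ℝ≥0∞) μ} (hSet : A.Setting r ρ σ ω C u₀) {t : ℝ} (ht : 0 < t) (s : ℝ≥0)
    [Fact (1 ≤ (s : ℝ≥0∞))] :
    ∃! S : Lp ℝ (s : ℝ≥0∞) μ → Lp ℝ (s : ℝ≥0∞) μ, IsContinuousExtension (A.semigroup t) S := by
  set W := {w : Lp ℝ (s : ℝ≥0∞) μ | MemLp w q μ} with hW
  have hWd : Dense W := (dense_memLp_and_memLp_top q s).mono fun w hw => hw.1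
  have hmem : ∀ w : W, MemLp (A.semigroup t (MemLp.toLp _ w.2)) s μ := fun w =>
    hSet.memLp_semigroup ht s ((Lp.memLp w.1).ae_eq (MemLp.coeFn_toLp w.2).symm)
  set f : W → Lp ℝ (s : ℝ≥0∞) μ := fun w => (hmem w).toLp _ with hf
  have hlip : LipschitzWith (Real.toNNReal (Real.exp (ω * t))) f := by
    refine LipschitzWith.of_dist_le_mul fun w w' => ?_
    rw [Subtype.dist_eq, dist_eq_norm, dist_eq_norm, Real.coe_toNNReal _ (Real.exp_pos _).le,
      Lp.norm_def, Lp.norm_def, ← ENNReal.toReal_ofReal (Real.exp_pos (ω * t)).le,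
      ← ENNReal.toReal_mul]
    refine ENNReal.toReal_mono (ENNReal.mul_ne_top ENNReal.ofReal_ne_top (Lp.eLpNorm_ne_top _)) ?_
    have h1 := eLpNorm_semigroup_le hSet.mCompletelyAccretive hSet.omega_nonneg
      hSet.dense_domain ht (MemLp.toLp _ w.2) (MemLp.toLp _ w'.2) (p := s) Fact.out
    convert h1 using 1
    · refine eLpNorm_congr_ae ?_
      filter_upwards [Lp.coeFn_sub (f w) (f w'), (hmem w).coeFn_toLp, (hmem w').coeFn_toLp,
        Lp.coeFn_sub (A.semigroup t (MemLp.toLp _ w.2)) (A.semigroup t (MemLp.toLp _ w'.2))]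
        with x e1 e2 e3 e4
      rw [e1, e4, Pi.sub_apply, Pi.sub_apply, hf]
      simp only
      rw [e2, e3]
    · congr 1
      refine eLpNorm_congr_ae ?_
      filter_upwards [Lp.coeFn_sub w.1 w'.1, MemLp.coeFn_toLp w.2, MemLp.coeFn_toLp w'.2,
        Lp.coeFn_sub (MemLp.toLp _ w.2) (MemLp.toLp _ w'.2)] with x e1 e2 e3 e4
      rw [e1, e4, Pi.sub_apply, Pi.sub_apply, e2, e3]
  refine ⟨hWd.extend f, ⟨(hWd.uniformContinuous_extend hlip.uniformContinuous).continuous, ?_⟩, ?_⟩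
  · intro u w huw
    have hw : w ∈ W := (Lp.memLp u).ae_eq huw
    have h1 : hWd.extend f w = f ⟨w, hw⟩ := hWd.extend_of_ind hlip.uniformContinuous ⟨w, hw⟩
    have h2 : MemLp.toLp _ hw = u := Lp.ext ((MemLp.coeFn_toLp hw).trans huw.symm)
    have h3 := (hmem ⟨w, hw⟩).coeFn_toLp
    rw [h1]
    simp only [hf]
    refine EventuallyEq.trans ?_ h3.symm
    rw [← h2]
  · intro S' hS'
    refine (hWd.extend_unique ?_ hS'.1).symm
    intro w
    refine Lp.ext ?_
    exact (hS'.2 _ _ (MemLp.coeFn_toLp w.2)).symm.trans (hmem w).coeFn_toLp.symm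

/-- A smoothing estimate for bounded data extends to all data in `L^s`. -/
theorem Operator.Setting.eLpNorm_top_extension_sub_le {r : ℝ≥0∞} {ρ σ C : ℝ}
    {u₀ : Lp ℝ (q : ℝ≥0∞) μ} (hSet : A.Setting r ρ σ ω C u₀) {t : ℝ} {s : ℝ≥0}
    [Fact (1 ≤ (s : ℝ≥0∞))] {M g : ℝ} (hM : 0 ≤ M) (hg : 0 ≤ g)
    (hbound : ∀ (u : Lp ℝ (q : ℝ≥0∞) μ) (B S : ℝ), 0 < B → 0 < S →
      (∀ᵐ a ∂μ, |(u - u₀ : Lp ℝ (q : ℝ≥0∞) μ) a| ≤ B) →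
      levelInt μ s 0 (u - u₀ : Lp ℝ (q : ℝ≥0∞) μ) ≤ ENNReal.ofReal (S ^ (s : ℝ)) →
      ∀ᵐ a ∂μ, |(A.semigroup t u - u₀ : Lp ℝ (q : ℝ≥0∞) μ) a| ≤ M * S ^ g)
    {S : Lp ℝ (s : ℝ≥0∞) μ → Lp ℝ (s : ℝ≥0∞) μ}
    (hS : IsContinuousExtension (A.semigroup t) S) (u : Lp ℝ (s : ℝ≥0∞) μ) :
    eLpNorm (fun x => S u x - u₀ x) ∞ μ ≤
      ENNReal.ofReal M * eLpNorm (fun x => u x - u₀ x) s μ ^ g := by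
  have hs := one_le_coe_of_fact s
  have h0 : MemLp u₀ s μ := memLp_of_memLp_one_top hSet.memLp_one hSet.memLp_top s
  set w₀ : Lp ℝ (s : ℝ≥0∞) μ := h0.toLp _ with hw₀
  have hw₀x : w₀ =ᵐ[μ] u₀ := h0.coeFn_toLp
  have hsub : ∀ w : Lp ℝ (s : ℝ≥0∞) μ, (w - w₀ : Lp ℝ (s : ℝ≥0∞) μ) =ᵐ[μ]
      fun x => w x - u₀ x := fun w => by
    filter_upwards [Lp.coeFn_sub w w₀, hw₀x] with x e1 e2
    rw [e1, Pi.sub_apply, e2]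
  obtain ⟨w, hw, hwu⟩ := mem_closure_iff_seq_limit.1
    ((dense_memLp_and_memLp_top (μ := μ) q s).closure_eq ▸ Set.mem_univ u)
  -- The added `1 / (n + 1)` keeps the bound positive, as `hbound` demands, even when `w n = w₀`.
  set N : ℕ → ℝ := fun n => ‖w n - w₀‖ + 1 / ((n : ℝ) + 1) with hN
  have hNlim : Tendsto N atTop (𝓝 (‖u - w₀‖ + 0)) :=
    (hwu.sub_const w₀).norm.add tendsto_one_div_add_atTop_nhds_zero_nat
  rw [add_zero] at hNlim
  have hn : ∀ n, eLpNorm (S (w n) - w₀ : Lp ℝ (s : ℝ≥0∞) μ) ∞ μ ≤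
      ENNReal.ofReal (M * N n ^ g) := by
    intro n
    set v : Lp ℝ (q : ℝ≥0∞) μ := (hw n).1.toLp _ with hv
    have hvw : v =ᵐ[μ] w n := (hw n).1.coeFn_toLp
    have hT := hS.2 _ _ hvw
    have hvsub : (v - u₀ : Lp ℝ (q : ℝ≥0∞) μ) =ᵐ[μ] (w n - w₀ : Lp ℝ (s : ℝ≥0∞) μ) := by
      filter_upwards [Lp.coeFn_sub v u₀, hvw, hsub (w n)] with x e1 e2 e3
      rw [e1, e3, Pi.sub_apply, e2]
    have htop : MemLp (v - u₀ : Lp ℝ (q : ℝ≥0∞) μ) ∞ μ :=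
      (((hw n).2.sub hSet.memLp_top).ae_eq (hsub (w n)).symm).ae_eq hvsub.symm
    have hB := ae_abs_le_of_eLpNorm_top_le ENNReal.toReal_nonneg
      (ENNReal.ofReal_toReal htop.eLpNorm_ne_top).ge
    have hNpos : 0 < N n := by positivity
    have hlev : levelInt μ s 0 (v - u₀ : Lp ℝ (q : ℝ≥0∞) μ) ≤
        ENNReal.ofReal (N n ^ (s : ℝ)) := by
      rw [levelInt_congr hvsub, ← ofReal_norm_rpow]
      have : ‖w n - w₀‖ ≤ N n := by
        have : (0 : ℝ) ≤ 1 / ((n : ℝ) + 1) := by positivity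
        linarith
      gcongr
    have h1 := hbound v ((eLpNorm (v - u₀ : Lp ℝ (q : ℝ≥0∞) μ) ∞ μ).toReal + 1) (N n)
      (by positivity) hNpos (hB.mono fun x hx => hx.trans (by linarith)) hlev
    refine eLpNorm_top_le_of_ae_abs_le ?_
    filter_upwards [h1, Lp.coeFn_sub (A.semigroup t v) u₀, hT, hsub (S (w n))] with x e1 e2 e3 e4
    rw [e4, ← e3]
    rwa [e2, Pi.sub_apply] at e1
  have hfin := eLpNorm_le_of_tendsto (((hS.1.tendsto u).comp hwu).sub_const w₀)
    (ENNReal.tendsto_ofReal ((hNlim.rpow_const (Or.inr hg)).const_mul M))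
    (Eventually.of_forall hn)
  rw [← eLpNorm_congr_ae (hsub (S u)), ← eLpNorm_congr_ae (hsub u)]
  refine hfin.trans_eq ?_
  rw [ENNReal.ofReal_mul hM, Lp.norm_def, ← ENNReal.ofReal_rpow_of_nonneg ENNReal.toReal_nonneg hg,
    ENNReal.ofReal_toReal (Lp.eLpNorm_ne_top _)]

end Extension

end NonlinearSemigroup

open NonlinearSemigroup in
theorem mainTheorem2 (q : ℝ≥0) [Fact (1 ≤ (q : ℝ≥0∞))] (r : ℝ≥0∞) (hr : 1 ≤ r)
    (ρ σ C : ℝ) (hρ : 0 ≤ ρ) (hσ : 0 < σ) (hC : 0 < C) (γ : ℝ) (hγ : γ = gam q ρ σ) :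
    (∀ (Ω : Type*) [MeasurableSpace Ω] (μ : Measure Ω) [SigmaFinite μ]
        (A : Operator q μ) (ω : ℝ) (u₀ : Lp ℝ (q : ℝ≥0∞) μ),
        A.Setting r ρ σ ω C u₀ →
        ∀ t : ℝ, 0 < t → ∀ u : Lp ℝ (q : ℝ≥0∞) μ,
          Tendsto (A.expApprox t u) atTop (𝓝 (A.semigroup t u)) ∧
          eLpNorm (A.semigroup t u - u₀ : Lp ℝ (q : ℝ≥0∞) μ) r μ ≤
            ENNReal.ofReal ((C / q) ^ (1 / σ) * t ^ (-(1 / σ)) *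
              Real.exp (ω * (γ + 1) * t) * ‖u - u₀‖ ^ γ)) ∧
    (r ≠ ∞ → γ * r.toReal > q →
      ∀ m₀ : ℝ, m₀ ≥ q / γ → den q r.toReal γ m₀ > 0 →
      ∀ (s : ℝ≥0) [Fact (1 ≤ (s : ℝ≥0∞))], (s : ℝ) ≤ γ * r.toReal / q * m₀ →
        gammaStar q r.toReal γ m₀ * (1 - theta q r.toReal γ m₀ s) < 1 →
        ∃ K : ℝ, 0 < K ∧
          ∀ (Ω : Type*) [MeasurableSpace Ω] (μ : Measure Ω) [SigmaFinite μ]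
            (A : Operator q μ) (ω : ℝ) (u₀ : Lp ℝ (q : ℝ≥0∞) μ),
            A.Setting r ρ σ ω C u₀ →
            ∀ t : ℝ, 0 < t →
              (∃! S : Lp ℝ (s : ℝ≥0∞) μ → Lp ℝ (s : ℝ≥0∞) μ,
                IsContinuousExtension (A.semigroup t) S) ∧
              ∀ S : Lp ℝ (s : ℝ≥0∞) μ → Lp ℝ (s : ℝ≥0∞) μ,
                IsContinuousExtension (A.semigroup t) S →
                ∀ u : Lp ℝ (s : ℝ≥0∞) μ,
                  eLpNorm (fun x => S u x - u₀ x) ∞ μ ≤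
                    ENNReal.ofReal (K * t ^ (-alphaS q r.toReal σ γ m₀ s) *
                      Real.exp (ω * betaS q r.toReal γ m₀ s * t)) *
                    eLpNorm (fun x => u x - u₀ x) s μ ^ gammaS q r.toReal γ m₀ s) := by
  have hq := one_le_coe_of_fact q
  subst hγ
  refine ⟨fun Ω _ μ _ A ω u₀ hSet t ht u => ⟨Operator.tendsto_expApprox
    hSet.mCompletelyAccretive hSet.omega_nonneg hSet.dense_domain ht u,
    hSet.eLpNorm_semigroup_sub_le hr hρ hσ hC ht u⟩, ?_⟩
  intro hr' hγr m₀ hm₀ hden s _ _ hlt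
  have hs := one_le_coe_of_fact s
  have hq0 : (0 : ℝ) < q := by linarith
  have hR : 1 ≤ r.toReal := by
    rw [← ENNReal.toReal_one]
    exact (ENNReal.toReal_le_toReal ENNReal.one_ne_top hr').2 hr
  have hγ : 0 < gam q ρ σ := by rw [gam]; positivity
  have hm0 : 0 < m₀ := lt_of_lt_of_le (by positivity) hm₀
  have hR0 : 0 < r.toReal := by linarith
  have hκ : 1 < gam q ρ σ * r.toReal / q := (one_lt_div hq0).2 hγr
  have hD : 0 < ((s : ℝ) - q) * (gam q ρ σ * r.toReal / q - 1) + (r.toReal - q) := by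
    have h1 := one_sub_gammaStar_mul (s := s) hq0 hR0 hγ hm0 hden
    have h2 : 0 < gam q ρ σ * r.toReal / q * den q r.toReal (gam q ρ σ) m₀ := by positivity
    have h3 := sub_pos.2 hlt
    rw [h1] at h3
    exact (div_pos_iff_of_pos_right h2).1 h3
  have hα := alphaS_eq (σ := σ) hq0 hR0 hγ hm0 hden hD
  have hγs := gammaS_eq hq0 hR0 hγ hm0 hden hD
  have hβ := gammaS_lt_betaS hq hγ hκ hm₀ hden hlt
  rw [hγs] at hβ
  obtain ⟨K, hK, hmain⟩ := Operator.Setting.exists_smoothing_of_bounded hr hr' hρ hσ hC q hκ hs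
    rfl hD hβ
  refine ⟨K, hK, fun Ω _ μ _ A ω u₀ hSet t ht =>
    ⟨hSet.existsUnique_continuousExtension ht s, fun S hS u => ?_⟩⟩
  refine hSet.eLpNorm_top_extension_sub_le (by positivity) ?_ (fun v B N hB hN hvB hvN => ?_) hS u
  · rw [hγs]
    have : 0 < gam q ρ σ * r.toReal / q - 1 := by linarith
    positivity
  · rw [hα, hγs]
    exact hmain Ω μ A ω u₀ hSet t v B N ht hB hN hvB hvN
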